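/- Let $a<b$ be real numbers, let $I=[a,b]$, and let $f\colon I\to I$ be a continuous piecewise linear map with constant slope $s>1$; that is, there are points $a=p_0<p_1<\dots<p_{k+1}=b$ and real numbers $a_i,b_i$ with $|b_i|=s$ such that $f(x)=a_i+b_ix$ for all $x\in[p_i,p_{i+1}]$, $0\le i\le k$. A sequence $(x_i)_{i\ge 0}$ in $I$ is a $\delta$-pseudo-orbit if $|f(x_i)-x_{i+1}|<\delta$ for all $i\ge0$, and an asymptotic pseudo-orbit if $|f(x_i)-x_{i+1}|\to0$ as $i\to\infty$. A point $z\in I$ $\varepsilon$-shadows $(x_i)$ if $|x_i-f^i(z)|<\varepsilon$ for all $i\ge 0$, and asymptotically shadows $(x_i)$ if $|x_i-f^i(z)|\to0$ as $i\to\infty$. * $f$ has *shadowing* if for every $\varepsilon>0$ there is $\delta>0$ such that every $\delta$-pseudo-orbit is $\varepsilon$-shadowed by some point of $I$. * $f$ has *limit shadowing* if every asymptotic pseudo-orbit is asymptotically shadowed by some point of $I$. * $f$ has *s-limit shadowing* if for every $\varepsilon>0$ there is $\delta>0$ such that every $\delta$-pseudo-orbit is $\varepsilon$-shadowed by some point of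 $I$, and every $\delta$-pseudo-orbit that is also an asymptotic pseudo-orbit is both $\varepsilon$-shadowed and asymptotically shadowed by one and the same point of $I$. * A point $x\in I$ is *critical* if $x=a$, or $x=b$, or $f$ is not differentiable at $x$, or $f'(x)=0$. A point $x\in I$ is *linked* to $y\in I$ if for every $\varepsilon>0$ there are an integer $m\ge1$ and a point $z\in I$ with $f^m(z)=y$ and $|f^j(x)-f^j(z)|\le\varepsilon$ for $j=0,\dots,m$. The map $f$ has the *linking property* if every critical point of $f$ is linked to some critical point of $f$. * $f$ is *transitive* if for all non-empty open subsets $U,V$ of $I$ there is an integer $n\ge0$ with $f^n(U)\cap V\neq\emptyset$. Then the following are equivalent: 1. $f$ has s-limit shadowing; 2. $f$ has shadowing; 3. $f$ has the linking property. If furthermore $f$ is transitive, all of the above are additionally equivalent to 4. $f$ has limit shadowing. -/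

import Mathlib

open Filter Topology

namespace ShadowingInterval

section Dynamics

variable {X : Type*} [MetricSpace X]

/-- `x` is a `δ`-pseudo-orbit of `f`. -/
def IsPseudoOrbit (f : X → X) (δ : ℝ) (x : ℕ → X) : Prop :=
  ∀ i, dist (f (x i)) (x (i + 1)) < δ

/-- `x` is an asymptotic pseudo-orbit of `f`. -/
def IsAsymptoticPseudoOrbit (f : X → X) (x : ℕ → X) : Prop :=
  Tendsto (fun i => dist (f (x i)) (x (i + 1))) atTop (𝓝 0)

/-- The point `z` `ε`-shadows the sequence `x`. -/
def Shadows (f : X → X) (ε : ℝ) (z : X) (x : ℕ → X) : Prop :=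
  ∀ i, dist (x i) (f^[i] z) < ε

/-- The point `z` asymptotically shadows the sequence `x`. -/
def AsymptoticallyShadows (f : X → X) (z : X) (x : ℕ → X) : Prop :=
  Tendsto (fun i => dist (x i) (f^[i] z)) atTop (𝓝 0)

/-- The (classical) shadowing property. -/
def HasShadowing (f : X → X) : Prop :=
  ∀ ε > 0, ∃ δ > 0, ∀ x : ℕ → X, IsPseudoOrbit f δ x → ∃ z, Shadows f ε z x

/-- Limit shadowing: every asymptotic pseudo-orbit is asymptotically shadowed by some point. -/
def HasLimitShadowing (f : X → X) : Prop :=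
  ∀ x : ℕ → X, IsAsymptoticPseudoOrbit f x → ∃ z, AsymptoticallyShadows f z x

/-- s-limit shadowing: the same `δ` serves for `ε`-shadowing of `δ`-pseudo-orbits and for
asymptotic `ε`-shadowing of asymptotic `δ`-pseudo-orbits. -/
def HasSLimitShadowing (f : X → X) : Prop :=
  ∀ ε > 0, ∃ δ > 0,
    (∀ x : ℕ → X, IsPseudoOrbit f δ x → ∃ z, Shadows f ε z x) ∧
    (∀ x : ℕ → X, IsPseudoOrbit f δ x → IsAsymptoticPseudoOrbit f x →
      ∃ z, Shadows f ε z x ∧ AsymptoticallyShadows f z x)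

/-- `x` is `ε`-linked to `y` by `f`. -/
def IsEpsLinked (f : X → X) (ε : ℝ) (x y : X) : Prop :=
  ∃ m : ℕ, 1 ≤ m ∧ ∃ z : X, f^[m] z = y ∧ ∀ j ≤ m, dist (f^[j] x) (f^[j] z) ≤ ε

/-- `x` is linked to `y` by `f`. -/
def IsLinked (f : X → X) (x y : X) : Prop :=
  ∀ ε > 0, IsEpsLinked f ε x y

/-- The set `A` is linked by `f`: every point of `A` is linked to some point of `A`. -/
def IsLinkedSet (f : X → X) (A : Set X) : Prop :=
  ∀ x ∈ A, ∃ y ∈ A, IsLinked f x y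

/-- Topological transitivity. -/
def IsTransitive (f : X → X) : Prop :=
  ∀ U V : Set X, IsOpen U → IsOpen V → U.Nonempty → V.Nonempty →
    ∃ n : ℕ, ((f^[n] '' U) ∩ V).Nonempty

end Dynamics

section Interval

variable {a b : ℝ}

/-- `f : [a,b] → [a,b]` is piecewise linear with constant slope `s`: for some finite partition
`a = p 0 < p 1 < ⋯ < p (k + 1) = b`, the map is affine with slope `s` or `-s` on each of the
closed intervals of the partition. -/
def IsPiecewiseLinearConstSlope (f : Set.Icc a b → Set.Icc a b) (s : ℝ) : Prop :=
  0 ≤ s ∧ ∃ (k : ℕ) (p : Fin (k + 2) → ℝ), StrictMono p ∧ p 0 = a ∧ p (Fin.last (k + 1)) = b ∧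
    ∀ i : Fin (k + 1), ∃ α β : ℝ, |β| = s ∧
      ∀ x : Set.Icc a b, (x : ℝ) ∈ Set.Icc (p i.castSucc) (p i.succ) → (f x : ℝ) = α + β * x

/-- The set `Crit(f)` of critical points of `f : [a,b] → [a,b]`: the endpoints, the points where
`f` is not differentiable, and the points where its derivative vanishes. Differentiability is
that of the extension of `f` to `ℝ` by constants, which agrees with `f` near any point of the
open interval; the endpoints are critical in any case. -/
def Crit (hab : a ≤ b) (f : Set.Icc a b → Set.Icc a b) : Set (Set.Icc a b) :=
  {x | (x : ℝ) = a ∨ (x : ℝ) = b ∨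
    ¬ DifferentiableAt ℝ (Set.IccExtend hab (fun y => (f y : ℝ))) x ∨
    deriv (Set.IccExtend hab (fun y => (f y : ℝ))) x = 0}

/-- The linking property: the set of critical points is linked. -/
def HasLinkingProperty (hab : a ≤ b) (f : Set.Icc a b → Set.Icc a b) : Prop :=
  IsLinkedSet f (Crit hab f)

end Interval

end ShadowingInterval

namespace ShadowingInterval

/-! The map is affine of slope ±s between consecutive points of a finite set C, and near c ∈ C the
value f z depends only on |z - c|. So f^i maps a neighbourhood of c onto one side of f^i c,
stretching |z - c| by s^i, as long as the image intervals have no point of C inside (`IsFree`). This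
one-sidedness is the only obstruction to shadowing.

Linking implies s-limit shadowing through `HasPullback`: every target w near some later x n is
reached from a point near x 0. Away from C, expansion does this in one step. Near c ∈ C, the orbit
of c is followed. Either the distance to that orbit grows until the whole ball about x n lies on the
image side (`pullback_of_exit`), or at a later time m some f^m z ∈ C lies in the image interval
close to f^m c, and w can be reflected in f^m z to its far side (`pullback_of_reflection`).
Reflection preserves f w but not w, which is why `HasPullback` asks for f^(n+1) v = f w. Linking
provides the time m (`exists_isReturn`). Pullbacks are composed, with compactness at the end;
letting the scale shrink as the errors decay makes the same point shadow asymptotically.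

Shadowing implies linking by contraposition. If c is unlinked, its neighbourhoods are always mapped
to one side, the inner one, of its orbit. A pseudo-orbit that follows c and then jumps to the outer
side cannot be shadowed, since the two sides separate by expansion, unless the jump interval is
mapped across C (`exists_hit_of_jump`). By finiteness some d ∈ C then lies on the outer side
arbitrarily close to the orbit. Jumping onto d gives another hit, and the fold at d transfers it to
the inner side, which is a contradiction.

For transitive f, which is surjective, limit shadowing yields shadowing: unshadowed finite
pseudo-orbits are joined by chains into one asymptotic pseudo-orbit. -/

/-- `C` is a finite set containing the endpoints of `[a,b]`, and the continuous map `f` is affine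
of slope `±s` on every interval with no point of `C` inside and folds at each point of `C`. -/
structure IsFolding {a b : ℝ} (f : Set.Icc a b → Set.Icc a b) (C : Set (Set.Icc a b)) (s : ℝ) :
    Prop where
  one_lt : 1 < s
  lt : a < b
  cont : Continuous f
  finite : C.Finite
  left_mem : ∀ x : Set.Icc a b, (x : ℝ) = a → x ∈ C
  right_mem : ∀ x : Set.Icc a b, (x : ℝ) = b → x ∈ C
  affine : ∀ u v : Set.Icc a b,
    (∀ c ∈ C, |(c : ℝ) - u| < |(v : ℝ) - u| → |(c : ℝ) - v| < |(v : ℝ) - u| → False) →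
    ∃ σ : ℝ, |σ| = 1 ∧ ∀ x : Set.Icc a b, |(x : ℝ) - u| ≤ |(v : ℝ) - u| →
      |(x : ℝ) - v| ≤ |(v : ℝ) - u| → (f x : ℝ) = f u + σ * (s * |(x : ℝ) - u|)
  fold : ∀ c ∈ C, ∃ ρ > 0, ∃ σ : ℝ, |σ| = 1 ∧ ∀ z : Set.Icc a b, |(z : ℝ) - c| ≤ ρ →
    (f z : ℝ) = f c + σ * (s * |(z : ℝ) - c|)

/-! ### Constant slope maps fold exactly at their critical points. -/

section PiecewiseLinear

variable {a b : ℝ}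

lemma exists_piece {k : ℕ} {p : Fin (k + 2) → ℝ} (h0 : p 0 = a)
    (h1 : p (Fin.last (k + 1)) = b) {x : ℝ} (hx : x ∈ Set.Icc a b) :
    ∃ i : Fin (k + 1), x ∈ Set.Icc (p i.castSucc) (p i.succ) := by
  by_contra! h
  have key : ∀ j : Fin (k + 2), p j ≤ x := by
    intro j
    induction j using Fin.induction with
    | zero => rw [h0]; exact hx.1
    | succ i ih =>
      by_contra! h2
      exact h i ⟨ih, h2.le⟩
  have h2 := key (Fin.last k).castSucc
  apply h (Fin.last k)
  refine ⟨h2, ?_⟩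
  rw [Fin.succ_last, h1]
  exact hx.2

/-- A nondegenerate piece containing x already determines the derivative, so x may be a partition
point. -/
lemma IsPiecewiseLinearConstSlope.abs_deriv (hab : a < b) {f : Set.Icc a b → Set.Icc a b} {s : ℝ}
    (hpl : IsPiecewiseLinearConstSlope f s) {x : ℝ} (hx : x ∈ Set.Icc a b)
    (hd : DifferentiableAt ℝ (Set.IccExtend hab.le (fun y => (f y : ℝ))) x) :
    |deriv (Set.IccExtend hab.le (fun y => (f y : ℝ))) x| = s := by
  obtain ⟨-, k, p, hp, h0, h1, h⟩ := hpl
  obtain ⟨i, hi⟩ := exists_piece h0 h1 hx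
  obtain ⟨α, β, hβ, hf⟩ := h i
  have hlt : p i.castSucc < p i.succ := hp (Fin.castSucc_lt_succ)
  have hsub : Set.Icc (p i.castSucc) (p i.succ) ⊆ Set.Icc a b := by
    apply Set.Icc_subset_Icc
    · rw [← h0]; exact hp.monotone (Fin.zero_le _)
    · rw [← h1]; exact hp.monotone (Fin.le_last _)
  have e : ∀ y ∈ Set.Icc (p i.castSucc) (p i.succ),
      Set.IccExtend hab.le (fun y => (f y : ℝ)) y = α + β * y := by
    intro y hy
    rw [Set.IccExtend_of_mem _ _ (hsub hy)]
    exact hf ⟨y, hsub hy⟩ hy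
  have hw : HasDerivWithinAt (Set.IccExtend hab.le (fun y => (f y : ℝ))) β
      (Set.Icc (p i.castSucc) (p i.succ)) x := by
    have : HasDerivWithinAt (fun y : ℝ => α + β * y) β (Set.Icc (p i.castSucc) (p i.succ)) x := by
      simpa using ((hasDerivAt_id x).const_mul β).const_add α |>.hasDerivWithinAt
    exact this.congr e (e x hi)
  rw [UniqueDiffWithinAt.eq_deriv _ (uniqueDiffOn_Icc hlt x hi) hd.hasDerivAt.hasDerivWithinAt hw,
    hβ]

/-- Off the partition points f is locally affine with nonzero slope, so every critical point is a
partition point. -/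
lemma IsPiecewiseLinearConstSlope.finite_crit (hab : a < b) {f : Set.Icc a b → Set.Icc a b}
    {s : ℝ} (hs : 1 < s) (hpl : IsPiecewiseLinearConstSlope f s) : (Crit hab.le f).Finite := by
  have hpl' := hpl
  obtain ⟨-, k, p, hp, h0, h1, h⟩ := hpl
  apply Set.Finite.of_finite_image (f := Subtype.val) _ Subtype.val_injective.injOn
  apply (Set.finite_range p).subset
  rintro _ ⟨x, hx, rfl⟩
  by_contra hn
  obtain ⟨i, hi⟩ := exists_piece h0 h1 x.2
  obtain ⟨α, β, hβ, hf⟩ := h i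
  have hsub : Set.Icc (p i.castSucc) (p i.succ) ⊆ Set.Icc a b := by
    apply Set.Icc_subset_Icc
    · rw [← h0]; exact hp.monotone (Fin.zero_le _)
    · rw [← h1]; exact hp.monotone (Fin.le_last _)
  have e : ∀ y ∈ Set.Icc (p i.castSucc) (p i.succ),
      Set.IccExtend hab.le (fun y => (f y : ℝ)) y = α + β * y := by
    intro y hy
    rw [Set.IccExtend_of_mem _ _ (hsub hy)]
    exact hf ⟨y, hsub hy⟩ hy
  have hl : p i.castSucc < x := lt_of_le_of_ne hi.1 fun h => hn ⟨_, h⟩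
  have hr : x < p i.succ := lt_of_le_of_ne hi.2 fun h => hn ⟨_, h.symm⟩
  have hd : HasDerivAt (Set.IccExtend hab.le (fun y => (f y : ℝ))) β x := by
    have : HasDerivAt (fun y : ℝ => α + β * y) β x := by
      simpa using ((hasDerivAt_id (x : ℝ)).const_mul β).const_add α
    refine this.congr_of_eventuallyEq ?_
    filter_upwards [Icc_mem_nhds hl hr] with y hy using e y hy
  rcases hx with hx | hx | hx | hx
  · exact hn ⟨0, by rw [h0, hx]⟩
  · exact hn ⟨_, by rw [h1, hx]⟩
  · exact hx hd.differentiableAt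
  · rw [hd.deriv] at hx
    rw [hx] at hβ
    simp at hβ
    linarith

/-- The derivative does not vanish between critical points, so by Darboux it keeps its sign there;
its modulus is s, and the mean value theorem concludes. Noncritical partition points thus disappear.
-/
lemma IsPiecewiseLinearConstSlope.affine_of_lt (hab : a < b) {f : Set.Icc a b → Set.Icc a b}
    (hf : Continuous f) {s : ℝ} (hpl : IsPiecewiseLinearConstSlope f s) {u v : ℝ} (hu : a ≤ u) (hv : v ≤ b)
    (hC : ∀ c ∈ Crit hab.le f, (c : ℝ) ∉ Set.Ioo u v) :
    ∃ σ : ℝ, |σ| = 1 ∧ ∀ x ∈ Set.Icc u v, ∀ y ∈ Set.Icc u v,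
      Set.IccExtend hab.le (fun y => (f y : ℝ)) x - Set.IccExtend hab.le (fun y => (f y : ℝ)) y =
        σ * s * (x - y) := by
  set F := Set.IccExtend hab.le (fun y => (f y : ℝ)) with hF
  have hFc : Continuous F := (continuous_subtype_val.comp hf).Icc_extend'
  have hsub : Set.Ioo u v ⊆ Set.Icc a b := fun x hx => ⟨hu.trans hx.1.le, hx.2.le.trans hv⟩
  have hnot : ∀ x (hx : x ∈ Set.Ioo u v), DifferentiableAt ℝ F x ∧ deriv F x ≠ 0 := by
    intro x hx
    have := fun h => hC ⟨x, hsub hx⟩ h hx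
    exact ⟨by_contra fun h => this (Or.inr (Or.inr (Or.inl h))),
      fun h => this (Or.inr (Or.inr (Or.inr h)))⟩
  have hd : ∀ x ∈ Set.Ioo u v, DifferentiableAt ℝ F x := fun x hx => (hnot x hx).1
  have habs : ∀ x ∈ Set.Ioo u v, |deriv F x| = s := fun x hx =>
    hpl.abs_deriv hab (hsub hx) (hd x hx)
  obtain ⟨σ, hσ, hder⟩ : ∃ σ : ℝ, |σ| = 1 ∧ ∀ x ∈ Set.Ioo u v, deriv F x = σ * s := by
    rcases hasDerivWithinAt_forall_lt_or_forall_gt_of_forall_ne (convex_Ioo u v)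
      (fun x hx => (hd x hx).hasDerivAt.hasDerivWithinAt) (m := 0) (fun x hx => (hnot x hx).2)
      with h | h
    · refine ⟨-1, by simp, fun x hx => ?_⟩
      have := habs x hx
      rw [abs_of_neg (h x hx)] at this
      linarith
    · refine ⟨1, by simp, fun x hx => ?_⟩
      have := habs x hx
      rw [abs_of_pos (h x hx)] at this
      linarith
  have main : ∀ x ∈ Set.Icc u v, ∀ y ∈ Set.Icc u v, y < x → F x - F y = σ * s * (x - y) := by
    intro x hx y hy hyx
    have hs1 : Set.Ioo y x ⊆ Set.Ioo u v := Set.Ioo_subset_Ioo hy.1 hx.2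
    obtain ⟨c, hc, hc2⟩ := exists_deriv_eq_slope F hyx hFc.continuousOn
      (fun z hz => (hd z (hs1 hz)).differentiableWithinAt)
    rw [hder c (hs1 hc), eq_div_iff (by linarith)] at hc2
    exact hc2.symm
  refine ⟨σ, hσ, fun x hx y hy => ?_⟩
  rcases lt_trichotomy x y with h | h | h
  · have := main y hy x hx h
    linear_combination -this
  · simp [h]
  · exact main x hx y hy h

lemma IsPiecewiseLinearConstSlope.affine (hab : a < b) {f : Set.Icc a b → Set.Icc a b}
    (hf : Continuous f) {s : ℝ} (hpl : IsPiecewiseLinearConstSlope f s) (u v : Set.Icc a b)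
    (hC : ∀ c ∈ Crit hab.le f,
      |(c : ℝ) - u| < |(v : ℝ) - u| → |(c : ℝ) - v| < |(v : ℝ) - u| → False) :
    ∃ σ : ℝ, |σ| = 1 ∧ ∀ x : Set.Icc a b, |(x : ℝ) - u| ≤ |(v : ℝ) - u| →
      |(x : ℝ) - v| ≤ |(v : ℝ) - u| → (f x : ℝ) = f u + σ * (s * |(x : ℝ) - u|) := by
  have eF : ∀ x : Set.Icc a b, Set.IccExtend hab.le (fun y => (f y : ℝ)) x = f x :=
    fun x => Set.IccExtend_of_mem _ _ x.2
  rcases lt_trichotomy (u : ℝ) v with h | h | h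
  · obtain ⟨σ, hσ, H⟩ := hpl.affine_of_lt hab hf u.2.1 v.2.2 (by
      rintro c hc ⟨h1, h2⟩
      apply hC c hc
      · rw [abs_of_pos, abs_of_pos] <;> linarith
      · rw [abs_of_neg, abs_of_pos] <;> linarith)
    refine ⟨σ, hσ, fun x h1 h2 => ?_⟩
    rw [abs_of_pos (by linarith : (0 : ℝ) < v - u)] at h1 h2
    rw [abs_le] at h1 h2
    have := H x ⟨by linarith, by linarith⟩ u ⟨le_rfl, h.le⟩
    rw [eF, eF] at this
    rw [abs_of_nonneg (by linarith : (0 : ℝ) ≤ x - u)]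
    linarith
  · refine ⟨1, by simp, fun x h1 _ => ?_⟩
    rw [h, sub_self, abs_zero] at h1
    have h2 : (x : ℝ) = v := by
      have := abs_nonpos_iff.1 h1
      linarith
    have : x = u := Subtype.ext (h2.trans h.symm)
    subst this
    simp
  · obtain ⟨σ, hσ, H⟩ := hpl.affine_of_lt hab hf v.2.1 u.2.2 (by
      rintro c hc ⟨h1, h2⟩
      apply hC c hc
      · rw [abs_of_neg, abs_of_neg] <;> linarith
      · rw [abs_of_pos, abs_of_neg] <;> linarith)
    refine ⟨-σ, by rwa [abs_neg], fun x h1 h2 => ?_⟩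
    rw [abs_of_neg (by linarith : (v - u : ℝ) < 0)] at h1 h2
    rw [abs_le] at h1 h2
    have := H x ⟨by linarith, by linarith⟩ u ⟨h.le, le_rfl⟩
    rw [eF, eF] at this
    rw [abs_of_nonpos (by linarith : (x - u : ℝ) ≤ 0)]
    linarith

lemma exists_pos_forall_dist_le_imp_eq {C : Set (Set.Icc a b)} (hC : C.Finite) (x : Set.Icc a b) :
    ∃ r > 0, ∀ c ∈ C, |(x : ℝ) - c| ≤ r → x = c := by
  have h : Set.Finite (C \ {x}) := hC.subset Set.sdiff_subset
  obtain ⟨r, hr, H⟩ := Metric.nhds_basis_closedBall.mem_iff.1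
    (h.isClosed.isOpen_compl.mem_nhds (x := x) (by simp))
  refine ⟨r, hr, fun c hc hcx => ?_⟩
  by_contra hne
  refine H (a := c) ?_ ⟨hc, fun h => hne h.symm⟩
  rw [Metric.mem_closedBall, dist_comm, Subtype.dist_eq, Real.dist_eq]
  exact hcx

/-- At an interior critical point both one-sided slopes are ±s. Were they equal, f would be
differentiable there with nonzero derivative; hence they are opposite and the two branches are
mirror images. An endpoint has a single branch. -/
lemma IsPiecewiseLinearConstSlope.fold (hab : a < b) {f : Set.Icc a b → Set.Icc a b}
    (hf : Continuous f) {s : ℝ} (hs : 1 < s) (hpl : IsPiecewiseLinearConstSlope f s)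
    (c : Set.Icc a b) (hc : c ∈ Crit hab.le f) :
    ∃ ρ > 0, ∃ σ : ℝ, |σ| = 1 ∧ ∀ z : Set.Icc a b, |(z : ℝ) - c| ≤ ρ →
      (f z : ℝ) = f c + σ * (s * |(z : ℝ) - c|) := by
  obtain ⟨r, hr, hgap⟩ := exists_pos_forall_dist_le_imp_eq (hpl.finite_crit hab hs) c
  have eF : ∀ x : Set.Icc a b, Set.IccExtend hab.le (fun y => (f y : ℝ)) x = f x :=
    fun x => Set.IccExtend_of_mem _ _ x.2
  have right : (c : ℝ) < b → ∃ σ : ℝ, |σ| = 1 ∧ ∀ z : Set.Icc a b, (c : ℝ) ≤ z →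
      |(z : ℝ) - c| ≤ r → (f z : ℝ) = f c + σ * (s * |(z : ℝ) - c|) := by
    intro h
    obtain ⟨σ, hσ, H⟩ := hpl.affine_of_lt hab hf (u := c) (v := min (c + r) b)
      c.2.1 (min_le_right _ _) (by
        rintro d hd ⟨h1, h2⟩
        have h3 := h2.trans_le (min_le_left _ _)
        have := hgap d hd (by rw [abs_of_neg] <;> linarith)
        rw [this] at h1
        exact lt_irrefl _ h1)
    refine ⟨σ, hσ, fun z h1 h2 => ?_⟩
    rw [abs_of_nonneg (by linarith : (0 : ℝ) ≤ z - c)] at h2 ⊢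
    have := H z ⟨h1, le_min (by linarith) z.2.2⟩ c ⟨le_rfl, le_min (by linarith) h.le⟩
    rw [eF, eF] at this
    linarith
  have left : a < (c : ℝ) → ∃ σ : ℝ, |σ| = 1 ∧ ∀ z : Set.Icc a b, (z : ℝ) ≤ c →
      |(z : ℝ) - c| ≤ r → (f z : ℝ) = f c + σ * (s * |(z : ℝ) - c|) := by
    intro h
    obtain ⟨σ, hσ, H⟩ := hpl.affine_of_lt hab hf (v := c) (u := max (c - r) a)
      (le_max_right _ _) c.2.2 (by
        rintro d hd ⟨h1, h2⟩
        have h3 := (le_max_left _ _).trans_lt h1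
        have := hgap d hd (by rw [abs_of_pos] <;> linarith)
        rw [this] at h2
        exact lt_irrefl _ h2)
    refine ⟨-σ, by rwa [abs_neg], fun z h1 h2 => ?_⟩
    rw [abs_of_nonpos (by linarith : (z - c : ℝ) ≤ 0)] at h2 ⊢
    have := H z ⟨max_le (by linarith) z.2.1, h1⟩ c ⟨max_le (by linarith) h.le, le_rfl⟩
    rw [eF, eF] at this
    linarith
  rcases c.2.1.eq_or_lt with ha | ha
  · obtain ⟨σ, hσ, H⟩ := right (by rw [← ha]; exact hab)
    exact ⟨r, hr, σ, hσ, fun z hz => H z (by rw [← ha]; exact z.2.1) hz⟩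
  rcases c.2.2.eq_or_lt with hb | hb
  · obtain ⟨σ, hσ, H⟩ := left ha
    exact ⟨r, hr, σ, hσ, fun z hz => H z (by rw [hb]; exact z.2.2) hz⟩
  obtain ⟨σ, hσ, HR⟩ := right hb
  obtain ⟨τ, hτ, HL⟩ := left ha
  by_cases hst : τ = σ
  · subst hst
    refine ⟨r, hr, τ, hτ, fun z hz => ?_⟩
    rcases le_total (c : ℝ) z with h | h
    · exact HR z h hz
    · exact HL z h hz
  · exfalso
    have hneg : τ = -σ := (abs_eq_abs.1 (hτ.trans hσ.symm)).resolve_left hst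
    have hd : HasDerivAt (Set.IccExtend hab.le (fun y => (f y : ℝ))) (σ * s) c := by
      have h1 : HasDerivAt (fun y : ℝ => (f c : ℝ) + σ * s * (y - c)) (σ * s) c := by
        simpa using (((hasDerivAt_id (c : ℝ)).sub_const (c : ℝ)).const_mul (σ * s)).const_add
          (f c : ℝ)
      refine h1.congr_of_eventuallyEq ?_
      filter_upwards [Icc_mem_nhds ha hb, Icc_mem_nhds (a := (c : ℝ) - r) (b := c + r)
        (by linarith) (by linarith)] with y hy hy2
      rw [Set.IccExtend_of_mem _ _ hy]
      have h3 : |((⟨y, hy⟩ : Set.Icc a b) : ℝ) - c| ≤ r := by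
        rw [abs_le]; constructor <;> simp <;> linarith [hy2.1, hy2.2]
      rcases le_total (c : ℝ) y with h | h
      · have := HR ⟨y, hy⟩ h h3
        rw [this, abs_of_nonneg (by simpa using h)]
        ring
      · have := HL ⟨y, hy⟩ h h3
        rw [this, abs_of_nonpos (by simpa using h), hneg]
        ring
    rcases hc with h | h | h | h
    · exact absurd h ha.ne'
    · exact absurd h hb.ne
    · exact h hd.differentiableAt
    · rw [hd.deriv] at h
      rcases mul_eq_zero.1 h with h | h
      · rw [h] at hσ; simp at hσ
      · linarith

theorem IsPiecewiseLinearConstSlope.isFolding (hab : a < b) {f : Set.Icc a b → Set.Icc a b}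
    (hf : Continuous f) {s : ℝ} (hs : 1 < s) (hpl : IsPiecewiseLinearConstSlope f s) :
    IsFolding f (Crit hab.le f) s where
  one_lt := hs
  lt := hab
  cont := hf
  finite := hpl.finite_crit hab hs
  left_mem _ h := Or.inl h
  right_mem _ h := Or.inr (Or.inl h)
  affine := hpl.affine hab hf
  fold := hpl.fold hab hf hs

end PiecewiseLinear

/-! ### Shadowing properties on metric spaces. -/

section Abstract

variable {X : Type*} [MetricSpace X]

/-- Targets near a later point of a pseudo-orbit can be pulled back to points near its initial
point, along orbits which follow the pseudo-orbit. -/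
def HasPullback (f : X → X) : Prop :=
  ∀ ε > 0, ∃ r > 0, ∃ δ > 0, r ≤ ε ∧ ∀ x : ℕ → X, IsPseudoOrbit f δ x → ∃ n, 1 ≤ n ∧
    ∀ w, dist w (x n) ≤ r → ∃ v, dist v (x 0) ≤ r ∧ f^[n + 1] v = f w ∧
      ∀ i ≤ n, dist (f^[i] v) (x i) ≤ ε

/-- Targets are pulled back through the last stage, then the one before, down to time 0; compactness
passes to infinitely many stages. Only images under f match at a junction, so each stage controls
the times i ≥ 1, and its initial time belongs to the previous stage. -/
lemma exists_forall_dist_iterate_le_of_stages [CompactSpace X] {f : X → X} (hf : Continuous f)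
    (x : ℕ → X) (t n : ℕ → ℕ) (R E : ℕ → ℝ) (ht0 : t 0 = 0) (ht : ∀ j, t (j + 1) = t j + n j)
    (hR : ∀ j, 0 ≤ R j) (hR' : ∀ j, R (j + 1) ≤ R j)
    (h : ∀ j w, dist w (x (t (j + 1))) ≤ R j → ∃ v, dist v (x (t j)) ≤ R j ∧
      f^[n j + 1] v = f w ∧ ∀ i ≤ n j, dist (f^[i] v) (x (t j + i)) ≤ E j) :
    ∃ z, dist z (x 0) ≤ R 0 ∧
      ∀ j i, 1 ≤ i → i ≤ n j → dist (f^[t j + i] z) (x (t j + i)) ≤ E j := by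
  have key : ∀ J w, dist w (x (t J)) ≤ R J → ∃ z, dist z (x 0) ≤ R 0 ∧ f^[t J + 1] z = f w ∧
      ∀ j < J, ∀ i, 1 ≤ i → i ≤ n j → dist (f^[t j + i] z) (x (t j + i)) ≤ E j := by
    intro J
    induction J with
    | zero =>
      intro w hw
      rw [ht0] at hw
      exact ⟨w, hw, by simp [ht0], fun j hj => absurd hj (Nat.not_lt_zero _)⟩
    | succ J ih =>
      intro w hw
      obtain ⟨v, hv, hvw, hvE⟩ := h J w (hw.trans (hR' J))
      obtain ⟨z, hz, hzv, hzE⟩ := ih v hv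
      have hi : ∀ i, 1 ≤ i → f^[t J + i] z = f^[i] v := by
        intro i hi
        obtain ⟨i, rfl⟩ := Nat.exists_eq_add_of_le' hi
        rw [show t J + (i + 1) = i + (t J + 1) by ring, Function.iterate_add_apply, hzv,
          ← Function.iterate_succ_apply]
      refine ⟨z, hz, ?_, fun j hj i h1 h2 => ?_⟩
      · rw [ht, add_assoc, hi _ (by omega), hvw]
      · rcases Nat.lt_succ_iff_lt_or_eq.1 hj with hj | rfl
        · exact hzE j hj i h1 h2
        · rw [hi i h1]
          exact hvE i h2
  let Z : ℕ → Set X := fun J => {z | dist z (x 0) ≤ R 0} ∩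
    ⋂ j, ⋂ (_ : j < J), ⋂ i, ⋂ (_ : 1 ≤ i ∧ i ≤ n j),
      {z | dist (f^[t j + i] z) (x (t j + i)) ≤ E j}
  have hmem : ∀ J z, z ∈ Z J ↔ dist z (x 0) ≤ R 0 ∧
      ∀ j < J, ∀ i, 1 ≤ i ∧ i ≤ n j → dist (f^[t j + i] z) (x (t j + i)) ≤ E j := by
    intro J z
    simp only [Z, Set.mem_inter_iff, Set.mem_iInter, Set.mem_ofPred_eq]
  have hclosed : ∀ J, IsClosed (Z J) := by
    intro J
    refine (isClosed_le (by fun_prop) continuous_const).inter ?_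
    refine isClosed_iInter fun j => isClosed_iInter fun _ => isClosed_iInter fun i =>
      isClosed_iInter fun _ => ?_
    exact isClosed_le ((hf.iterate _).dist continuous_const) continuous_const
  obtain ⟨z, hz⟩ := IsCompact.nonempty_iInter_of_sequence_nonempty_isCompact_isClosed Z
    (fun J z hz => by
      rw [hmem] at hz ⊢
      exact ⟨hz.1, fun j hj => hz.2 j (by omega)⟩)
    (fun J => by
      obtain ⟨z, h1, -, h3⟩ := key J (x (t J)) (by simpa using hR J)
      exact ⟨z, (hmem _ _).2 ⟨h1, fun j hj i hi => h3 j hj i hi.1 hi.2⟩⟩)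
    (hclosed 0).isCompact hclosed
  rw [Set.mem_iInter] at hz
  refine ⟨z, ((hmem _ _).1 (hz 0)).1, fun j i h1 h2 => ?_⟩
  exact ((hmem _ _).1 (hz (j + 1))).2 j (by omega) i ⟨h1, h2⟩

lemma exists_stage {t n : ℕ → ℕ} (ht0 : t 0 = 0) (ht : ∀ j, t (j + 1) = t j + n j)
    (hn : ∀ j, 1 ≤ n j) {i : ℕ} (hi : 1 ≤ i) : ∃ j k, 1 ≤ k ∧ k ≤ n j ∧ i = t j + k := by
  have hmono : ∀ j, j ≤ t j := by
    intro j
    induction j with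
    | zero => omega
    | succ j ih => have := ht j; have := hn j; omega
  have hex : ∃ j, i ≤ t j := ⟨i, hmono i⟩
  classical
  have h1 := Nat.find_spec hex
  have h2 := fun m => Nat.find_min hex (m := m)
  rcases hj : Nat.find hex with _ | j
  · rw [hj] at h1; omega
  · rw [hj] at h1
    have := h2 j (by omega)
    have := ht j
    exact ⟨j, i - t j, by omega, by omega, by omega⟩

theorem HasPullback.hasSLimitShadowing [CompactSpace X] {f : X → X} (hf : Continuous f)
    (h : HasPullback f) : HasSLimitShadowing f := by
  choose r hr δ hδ hrε h using h
  have h' : ∀ (ε : ℝ) (hε : ε > 0) (x : ℕ → X), ∃ n, 1 ≤ n ∧ (IsPseudoOrbit f (δ ε hε) x →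
    ∀ w, dist w (x n) ≤ r ε hε → ∃ v, dist v (x 0) ≤ r ε hε ∧ f^[n + 1] v = f w ∧
      ∀ i ≤ n, dist (f^[i] v) (x i) ≤ ε) := by
    intro ε hε x
    by_cases hx : IsPseudoOrbit f (δ ε hε) x
    · obtain ⟨n, h1, h2⟩ := h ε hε x hx
      exact ⟨n, h1, fun _ => h2⟩
    · exact ⟨1, le_rfl, fun h => absurd h hx⟩
  choose n hn1 hn using h'
  intro ε hε
  -- Each level is at most the radius `r` of the preceding one, so the radii do not increase with
  -- the level, as the chaining of stages requires.
  let e : ℕ → {ε : ℝ // ε > 0} := fun k => Nat.rec ⟨ε / 2, half_pos hε⟩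
    (fun _ p => ⟨min (r p.1 p.2) (p.1 / 2), lt_min (hr _ _) (half_pos p.2)⟩) k
  have he0 : (e 0).1 = ε / 2 := rfl
  have hes : ∀ k, (e (k + 1)).1 = min (r (e k).1 (e k).2) ((e k).1 / 2) := fun k => rfl
  have hehalf : ∀ k, (e (k + 1)).1 ≤ (e k).1 / 2 := fun k => by rw [hes]; exact min_le_right _ _
  have heanti : Antitone fun k => (e k).1 := antitone_nat_of_succ_le fun k => by
    have := hehalf k
    have := (e k).2
    linarith
  have hepow : ∀ k, (e k).1 ≤ ε / 2 * (1 / 2) ^ k := by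
    intro k
    induction k with
    | zero => simp [he0]
    | succ k ih => have := hehalf k; rw [pow_succ]; linarith
  have hetend : Tendsto (fun k => (e k).1) atTop (𝓝 0) := by
    refine squeeze_zero (fun k => (e k).2.le) hepow ?_
    simpa using (tendsto_pow_atTop_nhds_zero_of_lt_one (r := (1 / 2 : ℝ)) (by norm_num)
      (by norm_num)).const_mul (ε / 2)
  have main : ∀ x : ℕ → X, IsPseudoOrbit f (δ (e 0).1 (e 0).2) x →
      ∃ z, Shadows f ε z x ∧ (IsAsymptoticPseudoOrbit f x → AsymptoticallyShadows f z x) := by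
    intro x hx
    classical
    let tail : ℕ → ℕ → X := fun t i => x (t + i)
    let N : ℕ × ℕ → ℕ := fun p => n (e p.2).1 (e p.2).2 (tail p.1)
    let good : ℕ → ℕ → Prop := fun t k => IsPseudoOrbit f (δ (e k).1 (e k).2) (tail t)
    -- The state is the current time and level. The level rises by one whenever the remaining tail
    -- is precise enough for the next level.
    let st : ℕ → ℕ × ℕ := fun j => Nat.rec (0, 0)
      (fun _ p => (p.1 + N p, if good (p.1 + N p) (p.2 + 1) then p.2 + 1 else p.2)) j
    have hst0 : st 0 = (0, 0) := rfl
    have hst1 : ∀ j, (st (j + 1)).1 = (st j).1 + N (st j) := fun j => rfl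
    have hst2 : ∀ j, (st (j + 1)).2 =
      if good ((st (j + 1)).1) ((st j).2 + 1) then (st j).2 + 1 else (st j).2 := fun j => rfl
    have htail : ∀ t m k, good t k → good (t + m) k := by
      intro t m k h i
      have := h (m + i)
      simpa only [tail, add_assoc] using this
    have hgood : ∀ j, good (st j).1 (st j).2 := by
      intro j
      induction j with
      | zero => intro i; simpa [tail, hst0] using hx i
      | succ j ih =>
        rw [hst2]
        split_ifs with hg
        · exact hg
        · rw [hst1]
          exact htail _ _ _ ih
    have hkmono : Monotone fun j => (st j).2 := monotone_nat_of_le_succ fun j => by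
      rw [hst2]; split_ifs <;> omega
    have htj : ∀ j, j ≤ (st j).1 := by
      intro j
      induction j with
      | zero => omega
      | succ j ih => rw [hst1]; have : 1 ≤ N (st j) := hn1 _ _ _; omega
    obtain ⟨z, hz0, hz⟩ := exists_forall_dist_iterate_le_of_stages hf x (fun j => (st j).1)
      (fun j => N (st j)) (fun j => r (e (st j).2).1 (e (st j).2).2) (fun j => (e (st j).2).1)
      rfl hst1 (fun j => (hr _ _).le)
      (fun j => by
        rw [hst2]
        split_ifs with hg
        · refine (hrε _ _).trans ?_
          rw [hes]
          exact min_le_left _ _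
        · exact le_rfl)
      (fun j w hw => by
        have := hn _ _ _ (hgood j) w (by simpa only [tail, hst1] using hw)
        simpa only [tail, add_zero] using this)
    have hstage : ∀ i, 1 ≤ i → ∃ j k, 1 ≤ k ∧ k ≤ N (st j) ∧ i = (st j).1 + k := fun i hi =>
      exists_stage (t := fun j => (st j).1) (n := fun j => N (st j)) rfl hst1
        (fun j => hn1 _ _ _) hi
    refine ⟨z, fun i => ?_, fun hasy => ?_⟩
    · rw [dist_comm]
      rcases Nat.eq_zero_or_pos i with rfl | hi
      · refine (hz0.trans (hrε _ _)).trans_lt ?_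
        rw [hst0, he0]
        linarith
      · obtain ⟨j, k, h1, h2, rfl⟩ := hstage i hi
        refine (hz j k h1 h2).trans_lt ?_
        have := heanti (Nat.zero_le (st j).2)
        simp only [he0] at this
        linarith
    · have hunb : ∀ K, ∃ j, K ≤ (st j).2 := by
        intro K
        induction K with
        | zero => exact ⟨0, Nat.zero_le _⟩
        | succ K ih =>
          obtain ⟨j, hj⟩ := ih
          have hev : ∀ᶠ i in atTop, dist (f (x i)) (x (i + 1)) < δ (e (K + 1)).1 (e (K + 1)).2 :=
            hasy.eventually (gt_mem_nhds (hδ _ _))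
          obtain ⟨i0, hi0⟩ := eventually_atTop.1 hev
          refine ⟨j + i0 + 1, ?_⟩
          have h1 : K ≤ (st (j + i0)).2 := hj.trans (hkmono (by omega))
          rcases h1.eq_or_lt with h1 | h1
          · rw [hst2, ← h1, if_pos]
            intro i
            have := htj (j + i0 + 1)
            exact hi0 _ (by omega)
          · exact le_trans h1 (hkmono (Nat.le_succ (j + i0)))
      rw [AsymptoticallyShadows, Metric.tendsto_atTop]
      intro η hη
      obtain ⟨K, hK⟩ := (hetend.eventually (gt_mem_nhds hη)).exists
      obtain ⟨j0, hj0⟩ := hunb K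
      refine ⟨(st j0).1 + 1, fun i hi => ?_⟩
      obtain ⟨j, k, h1, h2, rfl⟩ := hstage i (by omega)
      rw [Real.dist_0_eq_abs, abs_of_nonneg dist_nonneg, dist_comm]
      refine (hz j k h1 h2).trans_lt (lt_of_le_of_lt (heanti ?_) hK)
      have htmono : Monotone fun j => (st j).1 := monotone_nat_of_le_succ fun j => by
        rw [hst1]; omega
      have : j0 ≤ j := by
        by_contra! hlt
        have h3 := htmono (show j + 1 ≤ j0 from hlt)
        simp only [hst1] at h3
        omega
      exact hj0.trans (hkmono this)
  refine ⟨δ (e 0).1 (e 0).2, hδ _ _, fun x hx => ?_, fun x hx hasy => ?_⟩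
  · obtain ⟨z, hz, -⟩ := main x hx
    exact ⟨z, hz⟩
  · obtain ⟨z, hz, hz'⟩ := main x hx
    exact ⟨z, hz, hz' hasy⟩

lemma HasSLimitShadowing.hasShadowing {f : X → X} (h : HasSLimitShadowing f) : HasShadowing f :=
  fun ε hε => let ⟨δ, hδ, h1, _⟩ := h ε hε; ⟨δ, hδ, h1⟩

/-- Only a tail is a δ-pseudo-orbit; a point shadowing it is moved back to time 0 by surjectivity,
since initial errors do not affect the limit. -/
lemma HasSLimitShadowing.hasLimitShadowing {f : X → X} (hsurj : Function.Surjective f)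
    (h : HasSLimitShadowing f) : HasLimitShadowing f := by
  intro x hx
  obtain ⟨δ, hδ, -, h⟩ := h 1 one_pos
  obtain ⟨N, hN⟩ := eventually_atTop.1 (hx.eventually (gt_mem_nhds hδ))
  obtain ⟨w, -, hw⟩ := h (fun i => x (i + N)) (fun i => by
      have := hN (i + N) (by omega)
      rwa [show i + N + 1 = i + 1 + N by ring] at this)
    (by
      have := (tendsto_add_atTop_iff_nat N).2 hx
      simpa only [IsAsymptoticPseudoOrbit, show ∀ i, i + 1 + N = i + N + 1 by intro i; ring]
        using this)
  obtain ⟨z, rfl⟩ := hsurj.iterate N w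
  refine ⟨z, ?_⟩
  rw [AsymptoticallyShadows, ← tendsto_add_atTop_iff_nat N]
  simpa only [AsymptoticallyShadows, ← Function.iterate_add_apply] using hw

/-- Otherwise the open complement of the range contains two points. A neighbourhood of one would
have to reach a disjoint open set of missed points near the other: time 0 is excluded by
disjointness, later times by being in the range. -/
lemma IsTransitive.surjective [CompactSpace X] {f : X → X} (hf : Continuous f)
    (hX : ∀ U : Set X, IsOpen U → U.Nonempty → ∃ x ∈ U, ∃ y ∈ U, x ≠ y)
    (h : IsTransitive f) : Function.Surjective f := by
  by_contra hns
  have hcl : IsClosed (Set.range f) := (isCompact_range hf).isClosed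
  have hne : (Set.range f)ᶜ.Nonempty := by
    rw [Set.nonempty_compl]
    exact fun h => hns (Set.range_eq_univ.1 h)
  obtain ⟨x, hx, y, hy, hxy⟩ := hX _ hcl.isOpen_compl hne
  obtain ⟨U, V, hU, hV, hxU, hyV, hUV⟩ := t2_separation hxy
  obtain ⟨n, _, ⟨u, hu, rfl⟩, hv⟩ := h U (V ∩ (Set.range f)ᶜ) hU (hV.inter hcl.isOpen_compl)
    ⟨x, hxU⟩ ⟨y, hyV, hy⟩
  rcases n with _ | n
  · exact Set.disjoint_left.1 hUV hu hv.1
  · rw [Function.iterate_succ_apply'] at hv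
    exact hv.2 ⟨_, rfl⟩

lemma IsTransitive.exists_chain {f : X → X} (hf : Continuous f) (hsurj : Function.Surjective f)
    (h : IsTransitive f) (x y : X) {δ : ℝ} (hδ : 0 < δ) :
    ∃ (l : ℕ) (g : ℕ → X), 1 ≤ l ∧ g 0 = x ∧ g l = y ∧ ∀ i < l, dist (f (g i)) (g (i + 1)) < δ := by
  obtain ⟨y', rfl⟩ := hsurj y
  -- Closeness is measured after one application of f, so that the first point of an orbit segment
  -- can be replaced by x and its last image by y exactly.
  have hopen : ∀ p : X, IsOpen {w | dist (f w) (f p) < δ / 2} := fun p =>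
    isOpen_lt (hf.dist continuous_const) continuous_const
  obtain ⟨n, _, ⟨w, hw, rfl⟩, hv⟩ := h _ _ (hopen x) (hopen y')
    ⟨x, by simpa using half_pos hδ⟩ ⟨y', by simpa using half_pos hδ⟩
  simp only [Set.mem_ofPred_eq] at hw hv
  refine ⟨n + 1, fun i => if i = 0 then x else if i = n + 1 then f y' else f^[i] w, by omega,
    by simp, by simp, fun i hi => ?_⟩
  have e : f (f^[i] w) = f^[i + 1] w := (Function.iterate_succ_apply' f i w).symm
  rcases Nat.eq_zero_or_pos i with rfl | hi0
  · rcases Nat.eq_zero_or_pos n with rfl | hn0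
    · simp only [Function.iterate_zero, id] at hv
      have := dist_triangle_left (f x) (f y') (f w)
      simp
      linarith
    · rw [dist_comm] at hw
      have : ¬ (n = 0) := by omega
      simp [this]
      linarith
  · by_cases hin : i = n
    · subst hin
      have h1 : ¬ i = 0 := by omega
      simp [h1]
      linarith
    · have h1 : ¬ i = 0 := by omega
      have h2 : ¬ i = n + 1 := by omega
      simp [h1, hin, h2, e, hδ]

/-- The last point of each block is the first point of the next, so block n contributes the indices
below `l n`, starting at time `T n`. -/
lemma exists_concat {f : X → X} (g : ℕ → ℕ → X) (l : ℕ → ℕ) (e : ℕ → ℝ) (hl : ∀ n, 1 ≤ l n)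
    (hg : ∀ n, ∀ i < l n, dist (f (g n i)) (g n (i + 1)) < e n)
    (hgl : ∀ n, g n (l n) = g (n + 1) 0) (he : Tendsto e atTop (𝓝 0)) :
    ∃ x : ℕ → X, IsAsymptoticPseudoOrbit f x ∧
      ∃ T : ℕ → ℕ, (∀ n, n ≤ T n) ∧ ∀ n, ∀ i < l n, x (T n + i) = g n i := by
  classical
  let st : ℕ → ℕ × ℕ := fun j => Nat.rec (0, 0)
    (fun _ p => if p.2 + 1 < l p.1 then (p.1, p.2 + 1) else (p.1 + 1, 0)) j
  have hst : ∀ j, st (j + 1) = if (st j).2 + 1 < l (st j).1 then ((st j).1, (st j).2 + 1)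
    else ((st j).1 + 1, 0) := fun j => rfl
  have hlt : ∀ j, (st j).2 < l (st j).1 := by
    intro j
    induction j with
    | zero => exact hl 0
    | succ j ih =>
      rw [hst]
      split_ifs with h
      · exact h
      · exact hl _
  have hstep : ∀ j, dist (f (g (st j).1 (st j).2)) (g (st (j + 1)).1 (st (j + 1)).2)
      < e (st j).1 := by
    intro j
    have := hg _ _ (hlt j)
    rw [hst]
    split_ifs with h
    · exact this
    · have h2 : (st j).2 + 1 = l (st j).1 := by have := hlt j; omega
      simpa only [← hgl, ← h2] using this
  have hrun : ∀ n T, st T = (n, 0) → ∀ i < l n, st (T + i) = (n, i) := by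
    intro n T hT i
    induction i with
    | zero => intro _; exact hT
    | succ i ih =>
      intro hi
      rw [← add_assoc, hst, ih (by omega)]
      simp [hi]
  have hreach : ∀ n, ∃ T, n ≤ T ∧ st T = (n, 0) := by
    intro n
    induction n with
    | zero => exact ⟨0, le_rfl, rfl⟩
    | succ n ih =>
      obtain ⟨T, hnT, hT⟩ := ih
      have h1 := hl n
      refine ⟨T + (l n - 1) + 1, by omega, ?_⟩
      rw [hst, hrun n T hT _ (by omega)]
      simp [show ¬ (l n - 1 + 1 < l n) by omega]
  choose T hT1 hT2 using hreach
  have hmono : Monotone fun j => (st j).1 := monotone_nat_of_le_succ fun j => by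
    rw [hst]; split_ifs <;> simp
  have htend : Tendsto (fun j => (st j).1) atTop atTop := by
    refine tendsto_atTop_atTop_of_monotone hmono fun n => ⟨T n, ?_⟩
    rw [hT2]
  refine ⟨fun j => g (st j).1 (st j).2, ?_, T, hT1, fun n i hi => ?_⟩
  · exact squeeze_zero (fun _ => dist_nonneg) (fun j => (hstep j).le) (he.comp htend)
  · simp only [hrun n (T n) (hT2 n) i hi]

lemma exists_shadows_of_finite [CompactSpace X] {f : X → X} (hf : Continuous f) {ε ε' : ℝ}
    (hε : ε' < ε) (x : ℕ → X) (h : ∀ L, ∃ z, ∀ i ≤ L, dist (x i) (f^[i] z) ≤ ε') :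
    ∃ z, Shadows f ε z x := by
  let Z : ℕ → Set X := fun L => ⋂ i, ⋂ (_ : i ≤ L), {z | dist (x i) (f^[i] z) ≤ ε'}
  have hmem : ∀ L z, z ∈ Z L ↔ ∀ i ≤ L, dist (x i) (f^[i] z) ≤ ε' := by
    intro L z
    simp only [Z, Set.mem_iInter, Set.mem_ofPred_eq]
  have hclosed : ∀ L, IsClosed (Z L) := fun L => isClosed_iInter fun i => isClosed_iInter fun _ =>
    isClosed_le (continuous_const.dist (hf.iterate _)) continuous_const
  obtain ⟨z, hz⟩ := IsCompact.nonempty_iInter_of_sequence_nonempty_isCompact_isClosed Z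
    (fun L z hz => by
      rw [hmem] at hz ⊢
      exact fun i hi => hz i (by omega))
    (fun L => let ⟨z, hz⟩ := h L; ⟨z, (hmem _ _).2 hz⟩)
    (hclosed 0).isCompact hclosed
  rw [Set.mem_iInter] at hz
  exact ⟨z, fun i => ((hmem _ _).1 (hz i) i le_rfl).trans_lt hε⟩

/-- If shadowing fails at ε, there are arbitrarily precise finite pseudo-orbits that no point
ε/2-shadows. Chains join them into an asymptotic pseudo-orbit; a point shadowing it asymptotically
would eventually ε/2-shadow a whole bad block. -/
theorem HasLimitShadowing.hasShadowing [CompactSpace X] {f : X → X} (hf : Continuous f)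
    (hsurj : Function.Surjective f) (ht : IsTransitive f) (h : HasLimitShadowing f) :
    HasShadowing f := by
  by_contra hns
  simp only [HasShadowing, not_forall, not_exists, not_and] at hns
  obtain ⟨ε, hε, hns⟩ := hns
  have hbad : ∀ n : ℕ, ∃ (x : ℕ → X) (L : ℕ), IsPseudoOrbit f (1 / ((n : ℝ) + 1)) x ∧
      ∀ z, ∃ i ≤ L, ε / 2 < dist (x i) (f^[i] z) := by
    intro n
    obtain ⟨x, hx, hz⟩ := hns (1 / ((n : ℝ) + 1)) (by positivity)
    by_contra! hcon
    obtain ⟨z, hz'⟩ := exists_shadows_of_finite hf (half_lt_self hε) x fun L => by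
      obtain ⟨z, hz⟩ := hcon x L hx
      exact ⟨z, hz⟩
    exact hz z hz'
  choose p L hp hL using hbad
  have hchain := fun n : ℕ => ht.exists_chain hf hsurj (p n (L n)) (p (n + 1) 0)
    (δ := 1 / ((n : ℝ) + 1)) (by positivity)
  choose l q hl hq0 hql hq using hchain
  obtain ⟨x, hx, T, hT, hxT⟩ := exists_concat (f := f)
    (fun n i => if i ≤ L n then p n i else q n (i - L n)) (fun n => L n + l n)
    (fun n => 1 / ((n : ℝ) + 1)) (fun n => by have := hl n; omega)
    (fun n i hi => by
      by_cases h1 : i + 1 ≤ L n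
      · rw [if_pos (by omega), if_pos h1]
        exact hp n i
      · rw [if_neg h1]
        by_cases h2 : i ≤ L n
        · have h3 : i = L n := by omega
          have := hq n 0 (hl n)
          rw [hq0] at this
          rw [if_pos h2, h3, show L n + 1 - L n = 0 + 1 by omega]
          exact this
        · rw [if_neg h2, show i + 1 - L n = i - L n + 1 by omega]
          exact hq n _ (by omega))
    (fun n => by
      have := hl n
      rw [if_neg (by omega), if_pos (Nat.zero_le _), Nat.add_sub_cancel_left]
      exact hql n)
    tendsto_one_div_add_atTop_nhds_zero_nat
  obtain ⟨z, hz⟩ := h x hx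
  obtain ⟨N, hN⟩ := eventually_atTop.1 (hz.eventually (gt_mem_nhds (half_pos hε)))
  obtain ⟨i, hi, hlt⟩ := hL N (f^[T N] z)
  have h1 := hN (T N + i) (by have := hT N; omega)
  rw [hxT N i (by have := hl N; omega), if_pos hi, add_comm (T N) i,
    Function.iterate_add_apply] at h1
  linarith

lemma exists_forall_pseudoOrbit_dist_iterate_lt [CompactSpace X] {f : X → X} (hf : Continuous f)
    (N : ℕ) {κ : ℝ} (hκ : 0 < κ) : ∃ δ > 0, ∀ x : ℕ → X, IsPseudoOrbit f δ x → ∀ j ≤ N,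
      dist (x j) (f^[j] (x 0)) < κ := by
  induction N generalizing κ with
  | zero =>
    refine ⟨1, one_pos, fun x _ j hj => ?_⟩
    obtain rfl : j = 0 := by omega
    simpa using hκ
  | succ N ih =>
    obtain ⟨η, hη, hu⟩ := Metric.uniformContinuous_iff.1
      (CompactSpace.uniformContinuous_of_continuous hf) (κ / 2) (half_pos hκ)
    obtain ⟨δ, hδ, h⟩ := ih (lt_min hη hκ)
    refine ⟨min δ (κ / 2), lt_min hδ (half_pos hκ), fun x hx j hj => ?_⟩
    have hN := h x fun i => (hx i).trans_le (min_le_left _ _)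
    rcases Nat.le_succ_iff.1 hj with hj | rfl
    · exact (hN j hj).trans_le (min_le_right _ _)
    · have h1 := hu ((hN N le_rfl).trans_le (min_le_left _ _))
      have h2 := (hx N).trans_le (min_le_right _ _)
      rw [Function.iterate_succ_apply']
      have := dist_triangle_left (x (N + 1)) (f (f^[N] (x 0))) (f (x N))
      linarith

end Abstract

/-! ### Free iteration of a fold. -/

section Free

variable {a b : ℝ}

/-- The first `n` iterates of `f` are affine on each side of `c` up to distance `ρ`, and fold the
two sides together. -/
def IsFree (f : Set.Icc a b → Set.Icc a b) (s : ℝ) (c : Set.Icc a b) (n : ℕ) (ρ : ℝ) : Prop :=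
  ∀ i, 1 ≤ i → i ≤ n → ∃ σ : ℝ, |σ| = 1 ∧ ∀ z : Set.Icc a b, |(z : ℝ) - c| ≤ ρ →
    (f^[i] z : ℝ) = f^[i] c + σ * (s ^ i * |(z : ℝ) - c|)

/-- Every point of `C` which is `T`-close to one of the first `N` iterates of a point of `C` is
equal to it. -/
def IsExact (f : Set.Icc a b → Set.Icc a b) (C : Set (Set.Icc a b)) (N : ℕ) (T : ℝ) : Prop :=
  ∀ i ≤ N, ∀ c ∈ C, ∀ d ∈ C, |(f^[i] c : ℝ) - d| ≤ T → f^[i] c = d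

variable {f : Set.Icc a b → Set.Icc a b} {C : Set (Set.Icc a b)} {s T ρ : ℝ} {N n : ℕ}
  {c : Set.Icc a b}

lemma IsFree.mono (h : IsFree f s c n ρ) {n' : ℕ} {ρ' : ℝ} (hn : n' ≤ n) (hρ : ρ' ≤ ρ) :
    IsFree f s c n' ρ' := fun i h1 h2 =>
  let ⟨σ, hσ, H⟩ := h i h1 (h2.trans hn)
  ⟨σ, hσ, fun z hz => H z (hz.trans hρ)⟩

lemma IsFree.dist_iterate (h : IsFree f s c n ρ) (hs : 0 < s) {i : ℕ} (hi : i ≤ n)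
    {z : Set.Icc a b} (hz : |(z : ℝ) - c| ≤ ρ) :
    |(f^[i] z : ℝ) - f^[i] c| = s ^ i * |(z : ℝ) - c| := by
  rcases Nat.eq_zero_or_pos i with rfl | h0
  · simp
  · obtain ⟨σ, hσ, H⟩ := h i h0 hi
    rw [H z hz, add_sub_cancel_left, abs_mul, hσ, one_mul, abs_of_nonneg (by positivity)]

lemma exists_isExact (hC : C.Finite) (f : Set.Icc a b → Set.Icc a b) (N : ℕ) :
    ∃ T > 0, IsExact f C N T := by
  have h1 : ∀ x : Set.Icc a b, ∀ᶠ T in 𝓝[>] (0 : ℝ), ∀ d ∈ C, |(x : ℝ) - d| ≤ T → x = d := by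
    intro x
    obtain ⟨r, hr, H⟩ := exists_pos_forall_dist_le_imp_eq hC x
    filter_upwards [Ioo_mem_nhdsGT hr] with T hT d hd hxd
    exact H d hd (hxd.trans hT.2.le)
  have h2 : ∀ᶠ T in 𝓝[>] (0 : ℝ), ∀ i ∈ Set.Iic N, ∀ c ∈ C, ∀ d ∈ C,
      |(f^[i] c : ℝ) - d| ≤ T → f^[i] c = d :=
    (Filter.eventually_all_finite (Set.finite_Iic N)).2 fun i _ =>
      (Filter.eventually_all_finite hC).2 fun c _ => h1 _
  obtain ⟨T, hT, hT0⟩ := (h2.and self_mem_nhdsWithin).exists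
  exact ⟨T, hT0, fun i hi => hT i hi⟩

namespace IsFolding

variable (h : IsFolding f C s)
include h

lemma pos : 0 < s := one_pos.trans h.one_lt

/-- Exactness at time 0 says that c is an endpoint of the interval or more than T away from it. So
the distance t ≤ T can be realised on the same side of c as x. -/
lemma exists_abs_sub_eq (hT : IsExact f C N T) (hc : c ∈ C) (x : Set.Icc a b) {t : ℝ}
    (ht : 0 ≤ t) (htT : t ≤ T) :
    ∃ v : Set.Icc a b, |(v : ℝ) - c| = t ∧ |(v : ℝ) - x| = |(|(x : ℝ) - c| - t)| := by
  have hab := h.lt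
  have gap := fun d hd => hT 0 (Nat.zero_le _) c hc d hd
  simp only [Function.iterate_zero, id] at gap
  have ha := gap ⟨a, Set.left_mem_Icc.2 hab.le⟩ (h.left_mem _ rfl)
  have hb := gap ⟨b, Set.right_mem_Icc.2 hab.le⟩ (h.right_mem _ rfl)
  simp only at ha hb
  have hca := c.2.1
  have hcb := c.2.2
  by_cases hr : (c : ℝ) + t ≤ b
  · by_cases hl : a ≤ (c : ℝ) - t
    · rcases le_total (c : ℝ) x with hx | hx
      · refine ⟨⟨c + t, by linarith, hr⟩, ?_, ?_⟩
        · simp [abs_of_nonneg ht]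
        · rw [abs_of_nonneg (by linarith : (0 : ℝ) ≤ x - c), ← abs_neg]
          congr 1; simp; ring
      · refine ⟨⟨c - t, hl, by linarith⟩, ?_, ?_⟩
        · simp [abs_of_nonneg ht]
        · rw [abs_of_nonpos (by linarith : (x - c : ℝ) ≤ 0)]
          congr 1; simp; ring
    · have e : (c : ℝ) = a := congrArg Subtype.val (ha (by rw [abs_of_nonneg] <;> linarith))
      have hx : (c : ℝ) ≤ x := by rw [e]; exact x.2.1
      refine ⟨⟨c + t, by linarith, hr⟩, ?_, ?_⟩
      · simp [abs_of_nonneg ht]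
      · rw [abs_of_nonneg (by linarith : (0 : ℝ) ≤ x - c), ← abs_neg]
        congr 1; simp; ring
  · have e : (c : ℝ) = b := congrArg Subtype.val (hb (by rw [abs_of_nonpos] <;> linarith))
    have hl : a ≤ (c : ℝ) - t := by
      by_contra hl
      have e' : (c : ℝ) = a := congrArg Subtype.val (ha (by rw [abs_of_nonneg] <;> linarith))
      linarith
    have hx : (x : ℝ) ≤ c := by rw [e]; exact x.2.2
    refine ⟨⟨c - t, hl, by linarith⟩, ?_, ?_⟩
    · simp [abs_of_nonneg ht]
    · rw [abs_of_nonpos (by linarith : (x - c : ℝ) ≤ 0)]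
      congr 1; simp; ring

lemma isFree_one (hT : IsExact f C N T) (hc : c ∈ C) : IsFree f s c 1 T := by
  intro i h1 h2
  obtain rfl : i = 1 := by omega
  obtain ⟨ρ, hρ, σ, hσ, H⟩ := h.fold c hc
  refine ⟨σ, hσ, fun z hz => ?_⟩
  simp only [Function.iterate_one, pow_one]
  obtain ⟨τ, hτ, H'⟩ := h.affine c z fun e he h1 h2 => by
    have : c = e := hT 0 (Nat.zero_le _) c hc e he (by
      rw [abs_sub_comm]; exact h1.le.trans hz)
    rw [← this, abs_sub_comm] at h2
    exact lt_irrefl _ h2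
  have ht : min ρ |(z : ℝ) - c| ≤ T := (min_le_right _ _).trans hz
  have ht0 : 0 ≤ min ρ |(z : ℝ) - c| := le_min hρ.le (abs_nonneg _)
  obtain ⟨x, hx1, hx2⟩ := h.exists_abs_sub_eq hT hc z ht0 ht
  have e1 := H x (by rw [hx1]; exact min_le_left _ _)
  have e2 := H' x (by rw [hx1]; exact min_le_right _ _) (by
    rw [hx2, abs_of_nonneg (sub_nonneg.2 (min_le_right _ _))]; linarith)
  have e3 := H' z le_rfl (by simp)
  rcases (abs_nonneg ((z : ℝ) - c)).eq_or_lt with h0 | h0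
  · rw [e3, ← h0]; simp
  · have hpos : 0 < s * |(x : ℝ) - c| := mul_pos h.pos (by rw [hx1]; exact lt_min hρ h0)
    -- The local fold and the affine branch on the whole of [c, z] are compared at a point other
    -- than c where both formulas hold.
    have : σ = τ := by
      have : σ * (s * |(x : ℝ) - c|) = τ * (s * |(x : ℝ) - c|) := by linarith
      exact mul_right_cancel₀ hpos.ne' this
    rw [this, e3]

lemma map_eq_of_abs_sub_eq (hT : IsExact f C N T) (hc : c ∈ C) {y z : Set.Icc a b}
    (hy : |(y : ℝ) - c| ≤ T) (hyz : |(z : ℝ) - c| = |(y : ℝ) - c|) : f z = f y := by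
  obtain ⟨σ, -, H⟩ := h.isFree_one hT hc 1 le_rfl le_rfl
  have e1 := H y hy
  have e2 := H z (by rwa [hyz])
  simp only [Function.iterate_one] at e1 e2
  exact Subtype.ext (by rw [e1, e2, hyz])

/-- The image is a one-sided interval issuing from f^n c, so another free step only requires that no
point of C be strictly inside it; points of C at its ends do no harm. -/
lemma isFree_succ (hz : ∃ z : Set.Icc a b, |(z : ℝ) - c| = ρ) (hF : IsFree f s c n ρ)
    (hn : 1 ≤ n)
    (hno : ∀ z : Set.Icc a b, |(z : ℝ) - c| = ρ → ∀ e ∈ C,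
      |(e : ℝ) - f^[n] c| < |(f^[n] z : ℝ) - f^[n] c| →
      |(e : ℝ) - f^[n] z| < |(f^[n] z : ℝ) - f^[n] c| → False) :
    IsFree f s c (n + 1) ρ := by
  intro i h1 h2
  rcases Nat.le_succ_iff.1 h2 with h2 | h2
  · exact hF i h1 h2
  obtain rfl : i = n + 1 := h2
  obtain ⟨w, hw⟩ := hz
  obtain ⟨τ, hτ, H⟩ := h.affine (f^[n] c) (f^[n] w) (hno w hw)
  refine ⟨τ, hτ, fun z hz => ?_⟩
  have hs := h.pos
  have hd := hF.dist_iterate hs le_rfl hz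
  have hdw := hF.dist_iterate hs le_rfl hw.le
  rw [hw] at hdw
  have hle : s ^ n * |(z : ℝ) - c| ≤ s ^ n * ρ := by gcongr
  have := H (f^[n] z) (by rw [hd, hdw]; exact hle) (by
    obtain ⟨σ, hσ, H⟩ := hF n hn le_rfl
    rw [hdw, H z hz, H w hw.le, hw,
      show (f^[n] c : ℝ) + σ * (s ^ n * |(z : ℝ) - c|) - (f^[n] c + σ * (s ^ n * ρ)) =
        σ * (s ^ n * |(z : ℝ) - c| - s ^ n * ρ) by ring, abs_mul, hσ, one_mul,
      abs_of_nonpos (by linarith)]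
    have : 0 ≤ s ^ n * |(z : ℝ) - c| := by positivity
    linarith)
  rw [Function.iterate_succ_apply', Function.iterate_succ_apply', this, hd]
  ring

/-- While the image intervals are no longer than T, a point of C inside one would have to equal its
end f^i c. -/
lemma isFree_of_isExact (hT : IsExact f C N T) (hc : c ∈ C) (hρ : 0 ≤ ρ)
    (hρT : s ^ N * ρ ≤ T) : IsFree f s c N ρ := by
  have hs := h.one_lt
  have hpow : ∀ i ≤ N, s ^ i * ρ ≤ T := fun i hi =>
    (mul_le_mul_of_nonneg_right (pow_le_pow_right₀ hs.le hi) hρ).trans hρT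
  have hρ1 : ρ ≤ T := by simpa using hpow 0 (Nat.zero_le _)
  have key : ∀ i ≤ N, IsFree f s c i ρ := by
    intro i
    induction i with
    | zero => intro _ j h1 h2; omega
    | succ i ih =>
      intro hi
      rcases Nat.eq_zero_or_pos i with rfl | h0
      · exact (h.isFree_one hT hc).mono le_rfl hρ1
      · refine h.isFree_succ ?_ (ih (by omega)) h0 fun z hz e he h1 h2 => ?_
        · obtain ⟨v, hv, -⟩ := h.exists_abs_sub_eq hT hc c hρ hρ1
          exact ⟨v, hv⟩
        · have hd := (ih (by omega)).dist_iterate h.pos le_rfl hz.le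
          rw [hz] at hd
          have := hT i (by omega) c hc e he (by
            rw [abs_sub_comm]; exact h1.le.trans (hd.trans_le (hpow i (by omega))))
          rw [← this, abs_sub_comm] at h2
          exact lt_irrefl _ h2
  exact key N le_rfl

/-- Here exactness is used at the other end of the image interval: from time n on, that end is the
orbit of d ∈ C. -/
lemma isFree_add_of_isExact (hT : IsExact f C N T) (hF : IsFree f s c n ρ) (hn : 1 ≤ n)
    {d z : Set.Icc a b} (hd : d ∈ C) (hz : |(z : ℝ) - c| = ρ) (hzd : f^[n] z = d)
    (hρT : s ^ (n + N) * ρ ≤ T) : IsFree f s c (n + N) ρ := by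
  have hs := h.one_lt
  have hρ : 0 ≤ ρ := hz ▸ abs_nonneg _
  have key : ∀ i ≤ N, IsFree f s c (n + i) ρ := by
    intro i
    induction i with
    | zero => intro _; exact hF
    | succ i ih =>
      intro hi
      have hFi := ih (by omega)
      refine h.isFree_succ (n := n + i) ⟨z, hz⟩ hFi (by omega) fun w hw e he h1 h2 => ?_
      have hdw := hFi.dist_iterate h.pos le_rfl hw.le
      have hwz : f^[n + i] w = f^[i] d := by
        obtain ⟨σ, -, H⟩ := hFi (n + i) (by omega) le_rfl
        rw [← hzd, ← Function.iterate_add_apply, add_comm i n]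
        exact Subtype.ext (by rw [H w hw.le, H z hz.le, hw, hz])
      have hle : s ^ (n + i) * ρ ≤ T :=
        (mul_le_mul_of_nonneg_right (pow_le_pow_right₀ hs.le (by omega)) hρ).trans hρT
      rw [hw] at hdw
      have := hT i (by omega) d hd e he (by
        rw [← hwz, abs_sub_comm]; exact h2.le.trans (hdw.trans_le hle))
      rw [← this, ← hwz] at h1
      exact lt_irrefl _ h1
  exact key N le_rfl

/-- If the interval swept out on one side of `f^[n] c` contains a point of `C`, the latter is the
image of a point near `c`. -/
lemma exists_of_between (hT : IsExact f C N T) (hc : c ∈ C) (hρT : ρ ≤ T) (hF : IsFree f s c n ρ)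
    (hn : 1 ≤ n) {e z : Set.Icc a b} (hz : |(z : ℝ) - c| = ρ)
    (h1 : |(e : ℝ) - f^[n] c| < |(f^[n] z : ℝ) - f^[n] c|)
    (h2 : |(e : ℝ) - f^[n] z| < |(f^[n] z : ℝ) - f^[n] c|) :
    ∃ w : Set.Icc a b, 0 < |(w : ℝ) - c| ∧ |(w : ℝ) - c| < ρ ∧ f^[n] w = e := by
  have hs := h.pos
  obtain ⟨σ, hσ, H⟩ := hF n hn le_rfl
  have hsn : 0 < s ^ n := pow_pos hs n
  have hdz := hF.dist_iterate hs le_rfl hz.le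
  have hσ2 : σ * σ = 1 := by rw [← abs_mul_abs_self, hσ, one_mul]
  obtain ⟨μ, hμ⟩ : ∃ μ, μ = σ * ((e : ℝ) - f^[n] c) := ⟨_, rfl⟩
  have he : (e : ℝ) = f^[n] c + σ * μ := by rw [hμ, ← mul_assoc, hσ2]; ring
  rw [hdz, hz] at h1 h2
  rw [he, add_sub_cancel_left, abs_mul, hσ, one_mul, abs_lt] at h1
  rw [H z hz.le, hz, he, show (f^[n] c : ℝ) + σ * μ - (f^[n] c + σ * (s ^ n * ρ)) =
    σ * (μ - s ^ n * ρ) by ring, abs_mul, hσ, one_mul, abs_lt] at h2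
  have hμ0 : 0 < μ := by linarith
  have hlt : μ / s ^ n < ρ := by rw [div_lt_iff₀ hsn]; linarith
  obtain ⟨w, hw, -⟩ := h.exists_abs_sub_eq hT hc c (t := μ / s ^ n) (by positivity)
    (hlt.le.trans hρT)
  refine ⟨w, by rw [hw]; positivity, by rwa [hw], Subtype.ext ?_⟩
  rw [H w (by rw [hw]; exact hlt.le), hw, he, mul_div_cancel₀ _ hsn.ne']

end IsFolding

end Free

/-! ### Linking implies the pullback property. -/

section Pullback

variable {a b : ℝ} {f : Set.Icc a b → Set.Icc a b} {C : Set (Set.Icc a b)} {s T ε₀ : ℝ} {N : ℕ}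
  {c : Set.Icc a b}

/-- Up to time `m` the point `c` is free at scales comparable with `ε₀`, and at time `m` its
one-sided neighbourhood of size `R` contains a point of `C` well inside. -/
def IsReturn (f : Set.Icc a b → Set.Icc a b) (C : Set (Set.Icc a b)) (s ε₀ : ℝ) (N : ℕ)
    (c : Set.Icc a b) (m : ℕ) : Prop :=
  1 ≤ m ∧ (∀ i ≤ m, IsFree f s c i (min (2 * s * (s ^ i * ε₀)) (s ^ N * ε₀ / 3) / s ^ i)) ∧
    ∃ (R : ℝ) (z : Set.Icc a b), f^[m] z ∈ C ∧ IsFree f s c m (R / s ^ m) ∧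
      2 * (s ^ m * |(z : ℝ) - c|) + (1 + s) / 2 * ε₀ ≤ R ∧
      2 * (s ^ m * |(z : ℝ) - c|) + (1 + s) / 2 * ε₀ ≤ s ^ m * ε₀ ∧
      (1 + s) * ε₀ ≤ R ∧ R ≤ s ^ N * ε₀

namespace IsFolding

variable (h : IsFolding f C s)
include h

/-- Let Q = s^N ε₀ and suppose the image interval of length Q at time n contains f^n z ∈ C. If f^n z
lies within Q/3 of f^n c, this is a return. Otherwise shrink the interval to end at f^n z: it stays
free for N more steps and, as s^N ≥ 3, again has length at least Q. With no such z, one more step is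
free. -/
lemma exists_isReturn_or_isFree (hT : IsExact f C N T) (hε₀ : 0 < ε₀) (hN : 6 * s ^ 2 ≤ s ^ N)
    (hNT : s ^ N * (s ^ N * ε₀) ≤ T) (hc : c ∈ C) (n : ℕ) (hn : N ≤ n) :
    (∃ m ≤ n, IsReturn f C s ε₀ N c m) ∨ ∃ j, n ≤ j ∧
      (∀ i ≤ j, IsFree f s c i (min (2 * s * (s ^ i * ε₀)) (s ^ N * ε₀ / 3) / s ^ i)) ∧
      IsFree f s c j (s ^ N * ε₀ / s ^ j) := by
  have hs := h.one_lt
  have hs0 := h.pos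
  have hpow : ∀ i : ℕ, 0 < s ^ i := fun i => pow_pos hs0 i
  have hs2 : s ≤ s ^ 2 := by nlinarith
  have hP6 : 6 * s ≤ s ^ N := by linarith
  have hQ0 : 0 < s ^ N * ε₀ := mul_pos (hpow N) hε₀
  have hQT : s ^ N * ε₀ ≤ T := by
    refine le_trans ?_ hNT
    nlinarith [hpow N]
  have h1N : 1 ≤ N := by
    by_contra hlt
    obtain rfl : N = 0 := by omega
    rw [pow_zero] at hP6
    linarith
  induction n, hn using Nat.le_induction with
  | base =>
    right
    have hF : IsFree f s c N (2 * s * ε₀) := by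
      refine h.isFree_of_isExact hT hc (by positivity) (le_trans ?_ hNT)
      gcongr
      linarith
    refine ⟨N, le_rfl, fun i hi => hF.mono hi ?_, hF.mono le_rfl ?_⟩
    · rw [div_le_iff₀ (hpow i)]
      refine (min_le_left _ _).trans (le_of_eq ?_)
      ring
    · rw [mul_div_cancel_left₀ _ (hpow N).ne']
      nlinarith
  | succ n hn ih =>
    rcases ih with ⟨m, hm, hm'⟩ | ⟨j, hj, hgood, hF⟩
    · exact Or.inl ⟨m, by omega, hm'⟩
    rcases hj.lt_or_eq with hj | rfl
    · exact Or.inr ⟨j, hj, hgood, hF⟩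
    have hρ0 : 0 < s ^ N * ε₀ / s ^ n := div_pos hQ0 (hpow n)
    have hρT : s ^ N * ε₀ / s ^ n ≤ T :=
      (div_le_self hQ0.le (one_le_pow₀ hs.le)).trans hQT
    by_cases hhit : ∃ z : Set.Icc a b, |(z : ℝ) - c| ≤ s ^ N * ε₀ / s ^ n ∧ 0 < |(z : ℝ) - c| ∧
      f^[n] z ∈ C
    · obtain ⟨z, hz, hz0, hzC⟩ := hhit
      by_cases hq : s ^ n * |(z : ℝ) - c| ≤ s ^ N * ε₀ / 3
      · left
        have hsq : s * ε₀ ≤ s ^ N * ε₀ / 6 := by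
          have : 6 * s * ε₀ ≤ s ^ N * ε₀ := by gcongr
          linarith
        have hsε : ε₀ ≤ s * ε₀ := by nlinarith
        have hNn : s ^ N * ε₀ ≤ s ^ n * ε₀ := by
          gcongr
          exact hs.le
        refine ⟨n, by omega, by omega, hgood, s ^ N * ε₀, z, hzC, hF, ?_, ?_, ?_, le_rfl⟩ <;>
          linarith
      · right
        push Not at hq
        have hFz : IsFree f s c n |(z : ℝ) - c| := hF.mono le_rfl hz
        have hF' := h.isFree_add_of_isExact hT hFz (by omega) hzC rfl rfl (by
          rw [le_div_iff₀ (hpow n)] at hz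
          refine le_trans ?_ hNT
          rw [pow_add, show s ^ n * s ^ N * |(z : ℝ) - c| = s ^ N * (|(z : ℝ) - c| * s ^ n) by ring]
          gcongr)
        refine ⟨n + N, by omega, fun i hi => ?_, hF'.mono le_rfl ?_⟩
        · rcases le_or_gt i n with hin | hin
          · exact hgood i hin
          · refine hF'.mono hi ?_
            rw [div_le_iff₀ (hpow i)]
            refine (min_le_right _ _).trans (hq.le.trans ?_)
            rw [mul_comm]
            gcongr
            exact hs.le
        · rw [div_le_iff₀ (hpow _), pow_add]
          nlinarith [hpow N]
    · right
      have hF' : IsFree f s c (n + 1) (s ^ N * ε₀ / s ^ n) := by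
        obtain ⟨v, hv, -⟩ := h.exists_abs_sub_eq hT hc c hρ0.le hρT
        refine h.isFree_succ ⟨v, hv⟩ hF (by omega) fun z hz e he h1 h2 => ?_
        obtain ⟨w, hw0, hw, hwe⟩ := h.exists_of_between hT hc hρT hF (by omega) hz h1 h2
        exact hhit ⟨w, hw.le, hw0, hwe ▸ he⟩
      have hle : s ^ N * ε₀ / s ^ (n + 1) ≤ s ^ N * ε₀ / s ^ n := by
        gcongr
        · exact hs.le
        · omega
      refine ⟨n + 1, le_rfl, fun i hi => ?_, hF'.mono le_rfl hle⟩
      rcases Nat.le_succ_iff.1 hi with hi' | rfl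
      · exact hgood i hi'
      · refine hF'.mono hi (le_trans ?_ hle)
        gcongr
        refine (min_le_right _ _).trans ?_
        linarith

lemma exists_isReturn (hT : IsExact f C N T) (hε₀ : 0 < ε₀) (hN : 6 * s ^ 2 ≤ s ^ N)
    (hNT : s ^ N * (s ^ N * ε₀) ≤ T) (hl : IsLinkedSet f C) (hc : c ∈ C) :
    ∃ m, IsReturn f C s ε₀ N c m := by
  have hs := h.one_lt
  have hs0 := h.pos
  have hpow : ∀ i : ℕ, 0 < s ^ i := fun i => pow_pos hs0 i
  obtain ⟨y, hy, hlink⟩ := hl c hc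
  -- With μ ≤ (s - 1)ε₀/4 one gets 2μ + (1 + s)ε₀/2 ≤ sε₀, the room that a return needs.
  obtain ⟨m, hm, z, rfl, hz⟩ := hlink ((s - 1) * ε₀ / 4) (by nlinarith)
  by_contra hno
  have hgood : ∀ i ≤ m,
      IsFree f s c i (min (2 * s * (s ^ i * ε₀)) (s ^ N * ε₀ / 3) / s ^ i) := by
    rcases h.exists_isReturn_or_isFree hT hε₀ hN hNT hc (max m N) (le_max_right _ _) with
      ⟨k, -, hk⟩ | ⟨j, hj, hgood, -⟩
    · exact absurd ⟨k, hk⟩ hno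
    · exact fun i hi => hgood i (hi.trans ((le_max_left _ _).trans hj))
  have hsε : ε₀ ≤ s * ε₀ := by nlinarith
  have hr : ∀ i, 1 ≤ i → 2 * s * s * ε₀ ≤ min (2 * s * (s ^ i * ε₀)) (s ^ N * ε₀ / 3) := by
    intro i hi
    refine le_min ?_ ?_
    · have : s ≤ s ^ i := le_self_pow₀ hs.le (by omega)
      rw [mul_assoc _ s ε₀]
      gcongr
    · have : 6 * s ^ 2 * ε₀ ≤ s ^ N * ε₀ := by gcongr
      linarith
  have hss : s * ε₀ ≤ s * s * ε₀ := by nlinarith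
  have hsm : s ≤ s ^ m := le_self_pow₀ hs.le (by omega)
  have hclose : ∀ j ≤ m, s ^ j * |(z : ℝ) - c| ≤ (s - 1) * ε₀ / 4 := by
    intro j
    induction j with
    | zero =>
      intro _
      have := hz 0 (Nat.zero_le _)
      rw [dist_comm, Subtype.dist_eq, Real.dist_eq] at this
      simpa using this
    | succ j ih =>
      intro hj
      have h1 := ih (by omega)
      have h2 : |(z : ℝ) - c| ≤
          min (2 * s * (s ^ (j + 1) * ε₀)) (s ^ N * ε₀ / 3) / s ^ (j + 1) := by
        rw [le_div_iff₀ (hpow _)]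
        refine le_trans ?_ (hr (j + 1) (by omega))
        have h3 : s * (s ^ j * |(z : ℝ) - c|) ≤ s * ((s - 1) * ε₀ / 4) := by gcongr
        rw [pow_succ]
        nlinarith
      rw [← (hgood (j + 1) hj).dist_iterate hs0 le_rfl h2]
      have := hz (j + 1) hj
      rwa [dist_comm, Subtype.dist_eq, Real.dist_eq] at this
  have hcm := hclose m le_rfl
  have hsmε : s * ε₀ ≤ s ^ m * ε₀ := by gcongr
  have hrm := hr m hm
  refine hno ⟨m, hm, hgood, _, z, hy, hgood m le_rfl, ?_, ?_, ?_, (min_le_right _ _).trans ?_⟩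
  · linarith
  · linarith
  · linarith
  · have : 0 < s ^ N * ε₀ := mul_pos (hpow N) hε₀
    linarith

lemma abs_iterate_sub_le {n : ℕ} {ρ κ Q : ℝ} (hF : IsFree f s c n ρ) {x v y : Set.Icc a b}
    (hx : |(x : ℝ) - c| ≤ ρ) (hv : |(v : ℝ) - c| ≤ ρ) (hxQ : s ^ n * |(x : ℝ) - c| ≤ Q)
    (hvQ : s ^ n * |(v : ℝ) - c| ≤ Q) {i : ℕ} (hi : i ≤ n) (hy : |(y : ℝ) - f^[i] x| ≤ κ) :
    |(f^[i] v : ℝ) - y| ≤ 2 * Q + κ := by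
  have hs := h.one_lt
  have hs0 := h.pos
  have e1 := hF.dist_iterate hs0 hi hv
  have e2 := hF.dist_iterate hs0 hi hx
  have l1 : s ^ i * |(v : ℝ) - c| ≤ s ^ n * |(v : ℝ) - c| := by gcongr; exact hs.le
  have l2 : s ^ i * |(x : ℝ) - c| ≤ s ^ n * |(x : ℝ) - c| := by gcongr; exact hs.le
  have t1 := abs_sub_le (f^[i] v : ℝ) (f^[i] c) y
  have t2 := abs_sub_le (f^[i] c : ℝ) (f^[i] x) y
  rw [abs_sub_comm (f^[i] c : ℝ) (f^[i] x), abs_sub_comm (f^[i] x : ℝ) y] at t2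
  linarith

/-- The target w is within ε₀ + (s - 1)ε₀/2 = (1 + s)ε₀/2 of f^j (x 0), hence on the image side of
f^j c. Pulling back divides this distance by s^j ≥ s, which leaves at most ε₀. -/
lemma pullback_of_exit (hT : IsExact f C N T) (hε₀ : 0 < ε₀) (hN : 6 * s ^ 2 ≤ s ^ N)
    (hQT : s ^ N * ε₀ ≤ T) (hc : c ∈ C) {m : ℕ}
    (hgood : ∀ i ≤ m, IsFree f s c i (min (2 * s * (s ^ i * ε₀)) (s ^ N * ε₀ / 3) / s ^ i))
    (x : ℕ → Set.Icc a b) (hx : ∀ j ≤ m, dist (x j) (f^[j] (x 0)) < (s - 1) / 2 * ε₀)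
    (hxc : |(x 0 : ℝ) - c| ≤ ε₀)
    (hex : ∃ j, (1 ≤ j ∧ j ≤ m) ∧ (1 + s) / 2 * ε₀ ≤ s ^ j * |(x 0 : ℝ) - c|) :
    ∃ n, 1 ≤ n ∧ ∀ w, dist w (x n) ≤ ε₀ → ∃ v, dist v (x 0) ≤ ε₀ ∧ f^[n + 1] v = f w ∧
      ∀ i ≤ n, dist (f^[i] v) (x i) ≤ 3 * (s ^ N * ε₀) := by
  have hs := h.one_lt
  have hs0 := h.pos
  have hpow : ∀ i : ℕ, 0 < s ^ i := fun i => pow_pos hs0 i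
  have hpow1 : ∀ i : ℕ, 1 ≤ s ^ i := fun i => one_le_pow₀ hs.le
  have hpows : ∀ i : ℕ, 1 ≤ i → s ≤ s ^ i := fun i hi => le_self_pow₀ hs.le (by omega)
  simp only [Subtype.dist_eq, Real.dist_eq] at hx ⊢
  obtain ⟨u, hu⟩ : ∃ u, u = |(x 0 : ℝ) - c| := ⟨_, rfl⟩
  have hu0 : 0 ≤ u := hu ▸ abs_nonneg _
  rw [← hu] at hxc hex
  have hsε : ε₀ ≤ s * ε₀ := by nlinarith
  have hssε : s * ε₀ ≤ s * s * ε₀ := by nlinarith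
  have hQ : 6 * (s * s * ε₀) ≤ s ^ N * ε₀ := by
    have : 6 * s ^ 2 * ε₀ ≤ s ^ N * ε₀ := by gcongr
    linarith
  classical
  obtain ⟨⟨hj1, hjm⟩, hju⟩ := Nat.find_spec hex
  have hmin := fun i => Nat.find_min hex (m := i)
  generalize Nat.find hex = j at hj1 hjm hju hmin
  -- Minimality of j bounds the distance to within a factor s of the threshold, so the interval
  -- needed is still in the free range.
  have hju' : s ^ j * u ≤ s * ((1 + s) / 2 * ε₀) := by
    obtain ⟨i, hi⟩ := Nat.exists_eq_add_of_le' hj1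
    rw [hi, pow_succ, mul_comm (s ^ i), mul_assoc]
    refine mul_le_mul_of_nonneg_left ?_ hs0.le
    rcases Nat.eq_zero_or_pos i with rfl | hi0
    · rw [pow_zero, one_mul]
      nlinarith
    · have := hmin i (by omega)
      push Not at this
      exact (this ⟨hi0, by omega⟩).le
  have hsj := hpows j hj1
  have hsjε : s * ε₀ ≤ s ^ j * ε₀ := by gcongr
  have hρ : ∀ t, t ≤ s ^ j * u + (1 + s) / 2 * ε₀ →
      t ≤ min (2 * s * (s ^ j * ε₀)) (s ^ N * ε₀ / 3) := by
    intro t ht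
    refine le_min ?_ ?_
    · have : s ^ j * u ≤ s ^ j * ε₀ := by gcongr
      have : 2 * 1 * (s ^ j * ε₀) ≤ 2 * s * (s ^ j * ε₀) := by gcongr
      linarith
    · nlinarith
  have hF := hgood j hjm
  have hu1 : u ≤ min (2 * s * (s ^ j * ε₀)) (s ^ N * ε₀ / 3) / s ^ j := by
    rw [le_div_iff₀ (hpow j), mul_comm]
    refine hρ _ (by nlinarith)
  obtain ⟨σ, hσ, H⟩ := hF j hj1 le_rfl
  have hσ2 : σ * σ = 1 := by rw [← abs_mul_abs_self, hσ, one_mul]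
  refine ⟨j, hj1, fun w hw => ?_⟩
  have he : |(w : ℝ) - f^[j] (x 0)| ≤ (1 + s) / 2 * ε₀ := by
    have := hx j hjm
    have := abs_sub_le (w : ℝ) (x j) (f^[j] (x 0))
    linarith
  obtain ⟨e, hedef⟩ : ∃ e, e = σ * ((w : ℝ) - f^[j] (x 0)) := ⟨_, rfl⟩
  have hwe : (w : ℝ) = f^[j] (x 0) + σ * e := by rw [hedef, ← mul_assoc, hσ2]; ring
  have heabs : |e| ≤ (1 + s) / 2 * ε₀ := by rw [hedef, abs_mul, hσ, one_mul]; exact he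
  have he2 := abs_le.1 heabs
  have ht0 : 0 ≤ s ^ j * u + e := by linarith
  have htr := hρ (s ^ j * u + e) (by linarith)
  have htQ : s ^ j * u + e ≤ s ^ N * ε₀ := by
    have := htr.trans (min_le_right _ _)
    linarith
  obtain ⟨v, hv, hvx⟩ := h.exists_abs_sub_eq hT hc (x 0) (t := (s ^ j * u + e) / s ^ j)
    (by positivity) ((div_le_self ht0 (hpow1 j)).trans (htQ.trans hQT))
  have hv1 : |(v : ℝ) - c| ≤ min (2 * s * (s ^ j * ε₀)) (s ^ N * ε₀ / 3) / s ^ j := by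
    rw [hv]; gcongr
  have hvs : s ^ j * |(v : ℝ) - c| = s ^ j * u + e := by
    rw [hv, mul_div_cancel₀ _ (hpow j).ne']
  refine ⟨v, ?_, ?_, fun i hi => ?_⟩
  · rw [hvx, ← hu, show u - (s ^ j * u + e) / s ^ j = -(e / s ^ j) by
      field_simp; ring, abs_neg, abs_div, abs_of_pos (hpow j), div_le_iff₀ (hpow j)]
    nlinarith
  · rw [Function.iterate_succ_apply']
    congr 1
    apply Subtype.ext
    rw [H v hv1, hvs, hwe, H (x 0) (hu ▸ hu1), ← hu]
    ring
  · have hjuQ : s ^ j * u ≤ s ^ N * ε₀ := by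
      have := (hρ (s ^ j * u) (by nlinarith)).trans (min_le_right _ _)
      linarith [mul_pos (hpow N) hε₀]
    refine (h.abs_iterate_sub_le hF (hu ▸ hu1) hv1 (hu ▸ hjuQ) (hvs ▸ htQ) hi
      (hx i (hi.trans hjm)).le).trans ?_
    nlinarith

/-- The point v is chosen so that f^m v lies beyond f^m z, as seen from f^m c, at the same distance
D from f^m z as w. The fold at f^m z ∈ C then identifies the images of f^m v and w. -/
lemma pullback_of_reflection (hT : IsExact f C N T) (hε₀ : 0 < ε₀) (hN : 6 * s ^ 2 ≤ s ^ N)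
    (hQT : s ^ N * ε₀ ≤ T) (hc : c ∈ C) {m : ℕ} (hm : IsReturn f C s ε₀ N c m)
    (x : ℕ → Set.Icc a b) (hx : ∀ j ≤ m, dist (x j) (f^[j] (x 0)) < (s - 1) / 2 * ε₀)
    (hxc : |(x 0 : ℝ) - c| ≤ ε₀)
    (hex : s ^ m * |(x 0 : ℝ) - c| < (1 + s) / 2 * ε₀) :
    ∃ n, 1 ≤ n ∧ ∀ w, dist w (x n) ≤ ε₀ → ∃ v, dist v (x 0) ≤ ε₀ ∧ f^[n + 1] v = f w ∧
      ∀ i ≤ n, dist (f^[i] v) (x i) ≤ 3 * (s ^ N * ε₀) := by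
  obtain ⟨hm1, -, R, z, hzC, hFR, hR1, hR2, hR3, hR4⟩ := hm
  have hs := h.one_lt
  have hs0 := h.pos
  have hpow : ∀ i : ℕ, 0 < s ^ i := fun i => pow_pos hs0 i
  have hpow1 : ∀ i : ℕ, 1 ≤ s ^ i := fun i => one_le_pow₀ hs.le
  have hpows : ∀ i : ℕ, 1 ≤ i → s ≤ s ^ i := fun i hi => le_self_pow₀ hs.le (by omega)
  simp only [Subtype.dist_eq, Real.dist_eq] at hx ⊢
  obtain ⟨u, hu⟩ : ∃ u, u = |(x 0 : ℝ) - c| := ⟨_, rfl⟩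
  have hu0 : 0 ≤ u := hu ▸ abs_nonneg _
  rw [← hu] at hxc hex
  have hsε : ε₀ ≤ s * ε₀ := by nlinarith
  have hssε : s * ε₀ ≤ s * s * ε₀ := by nlinarith
  have hQ : 6 * (s * s * ε₀) ≤ s ^ N * ε₀ := by
    have : 6 * s ^ 2 * ε₀ ≤ s ^ N * ε₀ := by gcongr
    linarith
  obtain ⟨μ, hμ⟩ : ∃ μ, μ = s ^ m * |(z : ℝ) - c| := ⟨_, rfl⟩
  have hμ0 : 0 ≤ μ := by rw [hμ]; positivity
  rw [← hμ] at hR1 hR2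
  have hsm := hpows m hm1
  have hsmε : s * ε₀ ≤ s ^ m * ε₀ := by gcongr
  have hu1 : u ≤ R / s ^ m := by
    rw [le_div_iff₀ (hpow m), mul_comm]
    nlinarith
  have hz1 : |(z : ℝ) - c| ≤ R / s ^ m := by
    rw [le_div_iff₀ (hpow m), mul_comm, ← hμ]
    nlinarith
  have humε : s ^ m * u ≤ s ^ m * ε₀ := by gcongr
  obtain ⟨σ, hσ, H⟩ := hFR m hm1 le_rfl
  refine ⟨m, hm1, fun w hw => ?_⟩
  have hD : |(w : ℝ) - f^[m] z| ≤ (1 + s) / 2 * ε₀ + |s ^ m * u - μ| := by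
    have h1 := hx m le_rfl
    have h2 := abs_sub_le (w : ℝ) (x m) (f^[m] z)
    have h3 := abs_sub_le (x m : ℝ) (f^[m] (x 0)) (f^[m] z)
    have h4 : |(f^[m] (x 0) : ℝ) - f^[m] z| = |s ^ m * u - μ| := by
      rw [H (x 0) (hu ▸ hu1), H z hz1, ← hμ, ← hu, add_sub_add_left_eq_sub, ← mul_sub, abs_mul, hσ,
        one_mul]
    linarith
  obtain ⟨D, hDdef⟩ : ∃ D, D = |(w : ℝ) - f^[m] z| := ⟨_, rfl⟩
  rw [← hDdef] at hD
  have hD0 : 0 ≤ D := hDdef ▸ abs_nonneg _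
  -- If f^m (x 0) is beyond f^m z, then μ + D is at most (1 + s)ε₀; otherwise it is at most 2μ + (1
  -- + s)ε₀/2. These are the bounds built into `IsReturn`.
  have ht : μ + D ≤ R ∧ |s ^ m * u - (μ + D)| ≤ s ^ m * ε₀ := by
    have : 0 ≤ s ^ m * u := by positivity
    have hlast : (1 + s) / 2 * ε₀ ≤ s ^ m * ε₀ := by nlinarith
    rw [abs_le]
    rcases abs_cases (s ^ m * u - μ) with ⟨h1, h2⟩ | ⟨h1, h2⟩ <;> rw [h1] at hD <;>
      refine ⟨?_, ?_, ?_⟩ <;> linarith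
  have htQ : μ + D ≤ s ^ N * ε₀ := ht.1.trans hR4
  obtain ⟨v, hv, hvx⟩ := h.exists_abs_sub_eq hT hc (x 0) (t := (μ + D) / s ^ m)
    (by positivity) ((div_le_self (by positivity) (hpow1 m)).trans (htQ.trans hQT))
  have hv1 : |(v : ℝ) - c| ≤ R / s ^ m := by
    rw [hv]; gcongr; exact ht.1
  have hvs : s ^ m * |(v : ℝ) - c| = μ + D := by
    rw [hv, mul_div_cancel₀ _ (hpow m).ne']
  refine ⟨v, ?_, ?_, fun i hi => ?_⟩
  · rw [hvx, ← hu, show u - (μ + D) / s ^ m = (s ^ m * u - (μ + D)) / s ^ m by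
      field_simp, abs_div, abs_of_pos (hpow m), div_le_iff₀ (hpow m), mul_comm ε₀]
    exact ht.2
  · rw [Function.iterate_succ_apply']
    refine h.map_eq_of_abs_sub_eq hT hzC (y := w) ?_ ?_
    · rw [← hDdef]
      linarith
    · rw [← hDdef, H v hv1, hvs, H z hz1, ← hμ, add_sub_add_left_eq_sub, ← mul_sub, add_sub_cancel_left,
        abs_mul, hσ, one_mul, abs_of_nonneg hD0]
  · have humQ : s ^ m * u ≤ s ^ N * ε₀ := by nlinarith
    refine (h.abs_iterate_sub_le hFR (hu ▸ hu1) hv1 (hu ▸ humQ) (hvs ▸ htQ) hi (hx i hi).le).trans ?_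
    nlinarith

lemma pullback_of_isReturn (hT : IsExact f C N T) (hε₀ : 0 < ε₀) (hN : 6 * s ^ 2 ≤ s ^ N)
    (hQT : s ^ N * ε₀ ≤ T) (hc : c ∈ C) {m : ℕ} (hm : IsReturn f C s ε₀ N c m)
    (x : ℕ → Set.Icc a b) (hx : ∀ j ≤ m, dist (x j) (f^[j] (x 0)) < (s - 1) / 2 * ε₀)
    (hxc : |(x 0 : ℝ) - c| ≤ ε₀) :
    ∃ n, 1 ≤ n ∧ ∀ w, dist w (x n) ≤ ε₀ → ∃ v, dist v (x 0) ≤ ε₀ ∧ f^[n + 1] v = f w ∧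
      ∀ i ≤ n, dist (f^[i] v) (x i) ≤ 3 * (s ^ N * ε₀) := by
  by_cases hex : ∃ j, (1 ≤ j ∧ j ≤ m) ∧ (1 + s) / 2 * ε₀ ≤ s ^ j * |(x 0 : ℝ) - c|
  · exact h.pullback_of_exit hT hε₀ hN hQT hc hm.2.1 x hx hxc hex
  · push Not at hex
    exact h.pullback_of_reflection hT hε₀ hN hQT hc hm x hx hxc (hex m ⟨hm.1, le_rfl⟩)

/-- The ball of radius ε₀ about x 0 is mapped affinely onto a ball of radius sε₀, which contains the
ball of radius ε₀ about x 1. -/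
lemma pullback_of_forall_lt (hε₀ : 0 < ε₀) (x : ℕ → Set.Icc a b)
    (hx : dist (f (x 0)) (x 1) ≤ (s - 1) * ε₀) (hC : ∀ e ∈ C, ε₀ < |(x 0 : ℝ) - e|) :
    ∀ w, dist w (x 1) ≤ ε₀ → ∃ v, dist v (x 0) ≤ ε₀ ∧ f v = w := by
  intro w hw
  have hs := h.one_lt
  have hs0 := h.pos
  have hab := h.lt
  have hx0 := (x 0).2
  have hl : a ≤ (x 0 : ℝ) - ε₀ := by
    have := hC ⟨a, Set.left_mem_Icc.2 hab.le⟩ (h.left_mem _ rfl)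
    rw [abs_of_nonneg (by simpa using hx0.1)] at this
    simp only at this
    linarith
  have hr : (x 0 : ℝ) + ε₀ ≤ b := by
    have := hC ⟨b, Set.right_mem_Icc.2 hab.le⟩ (h.right_mem _ rfl)
    rw [abs_of_nonpos (by simpa using hx0.2)] at this
    simp only at this
    linarith
  have huv : (x 0 : ℝ) + ε₀ - (x 0 - ε₀) = 2 * ε₀ := by ring
  obtain ⟨σ, hσ, H⟩ := h.affine ⟨x 0 - ε₀, hl, by linarith⟩ ⟨x 0 + ε₀, by linarith, hr⟩ (by
    intro e he h1 h2
    have := hC e he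
    simp only at h1 h2
    rw [huv, abs_of_pos (by linarith : 0 < 2 * ε₀), abs_lt] at h1 h2
    rw [lt_abs] at this
    rcases this with h | h <;> linarith)
  simp only [huv, abs_of_pos (by linarith : 0 < 2 * ε₀)] at H
  have hσ2 : σ * σ = 1 := by rw [← abs_mul_abs_self, hσ, one_mul]
  have he : |σ * ((w : ℝ) - f (x 0)) / s| ≤ ε₀ := by
    rw [Subtype.dist_eq, Real.dist_eq] at hx hw
    rw [abs_div, abs_mul, hσ, one_mul, abs_of_pos hs0, div_le_iff₀ hs0]
    have := abs_sub_le (w : ℝ) (x 1) (f (x 0))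
    rw [abs_sub_comm (x 1 : ℝ)] at this
    linarith
  obtain ⟨e, hedef⟩ : ∃ e, e = σ * ((w : ℝ) - f (x 0)) / s := ⟨_, rfl⟩
  rw [← hedef] at he
  have he2 := abs_le.1 he
  refine ⟨⟨x 0 + e, by linarith, by linarith⟩, ?_, Subtype.ext ?_⟩
  · rw [Subtype.dist_eq, Real.dist_eq]
    simpa using he
  · have e1 := H (x 0) (by rw [abs_le]; constructor <;> linarith)
      (by rw [abs_le]; constructor <;> linarith)
    have e2 := H ⟨x 0 + e, by linarith, by linarith⟩
      (by simp only; rw [abs_le]; constructor <;> linarith)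
      (by simp only; rw [abs_le]; constructor <;> linarith)
    simp only at e2
    rw [abs_of_nonneg (by linarith)] at e1 e2
    have e3 : s * e = σ * ((w : ℝ) - f (x 0)) := by
      rw [hedef, mul_div_cancel₀ _ hs0.ne']
    rw [e2]
    linear_combination -e1 + σ * e3 + ((w : ℝ) - f (x 0)) * hσ2

theorem hasPullback (hl : IsLinkedSet f C) : HasPullback f := by
  intro ε hε
  have hs := h.one_lt
  have hs0 := h.pos
  obtain ⟨N, hN⟩ := pow_unbounded_of_one_lt (6 * s ^ 2) hs
  obtain ⟨T, hT0, hT⟩ := exists_isExact h.finite f N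
  have hP : 0 < s ^ N := pow_pos hs0 N
  have hP1 : 1 ≤ s ^ N := one_le_pow₀ hs.le
  -- The first bound keeps an interval of length s^N ε₀ below T for N further steps; the second
  -- absorbs the tracking error.
  obtain ⟨ε₀, hε₀, h1, h2⟩ : ∃ ε₀ > 0, s ^ N * (s ^ N * ε₀) ≤ T ∧ 3 * (s ^ N * ε₀) ≤ ε := by
    refine ⟨min (T / (s ^ N * s ^ N)) (ε / (3 * s ^ N)), by positivity, ?_, ?_⟩
    · rw [← mul_assoc, ← le_div_iff₀' (by positivity)]
      exact min_le_left _ _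
    · rw [← mul_assoc, ← le_div_iff₀' (by positivity)]
      exact min_le_right _ _
  have hQ : ε₀ ≤ s ^ N * ε₀ := by nlinarith
  have hQT : s ^ N * ε₀ ≤ T := by nlinarith
  have hret := fun c (hc : c ∈ C) => h.exists_isReturn hT hε₀ hN.le h1 hl hc
  choose! m hm using hret
  obtain ⟨M, hM⟩ : ∃ M, ∀ c ∈ C, m c ≤ M := by
    obtain ⟨M, hM⟩ := (h.finite.image m).bddAbove
    exact ⟨M, fun c hc => hM ⟨c, hc, rfl⟩⟩
  have hκ : 0 < (s - 1) / 2 * ε₀ := by nlinarith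
  obtain ⟨δ, hδ, hx⟩ := exists_forall_pseudoOrbit_dist_iterate_lt h.cont M hκ
  refine ⟨ε₀, hε₀, min δ ((s - 1) / 2 * ε₀), lt_min hδ hκ, by linarith, fun x hpo => ?_⟩
  by_cases hC : ∃ c ∈ C, |(x 0 : ℝ) - c| ≤ ε₀
  · obtain ⟨c, hc, hxc⟩ := hC
    obtain ⟨n, hn, H⟩ := h.pullback_of_isReturn hT hε₀ hN.le hQT hc (hm c hc) x
      (fun j hj => hx x (fun i => (hpo i).trans_le (min_le_left _ _)) j (hj.trans (hM c hc))) hxc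
    refine ⟨n, hn, fun w hw => ?_⟩
    obtain ⟨v, hv, hvw, htr⟩ := H w hw
    exact ⟨v, hv, hvw, fun i hi => (htr i hi).trans h2⟩
  · push Not at hC
    refine ⟨1, le_rfl, fun w hw => ?_⟩
    obtain ⟨v, hv, rfl⟩ := h.pullback_of_forall_lt hε₀ x
      ((hpo 0).le.trans ((min_le_right _ _).trans (by nlinarith))) hC w hw
    refine ⟨v, hv, rfl, fun i hi => ?_⟩
    interval_cases i
    · exact hv.trans (by linarith)
    · exact hw.trans (by linarith)

end IsFolding

end Pullback

/-! ### Shadowing implies linking. -/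

section Linking

variable {a b : ℝ} {f : Set.Icc a b → Set.Icc a b} {C : Set (Set.Icc a b)} {s T ε : ℝ}
  {c : Set.Icc a b} {σ : ℕ → ℝ}

/-- No point of `C` is hit by an orbit which follows that of `c` up to distance `ε`, and `σ n`
is the side of `f^[n + 1] c` on which the images of the points near `c` lie. -/
structure IsUnlinked (f : Set.Icc a b → Set.Icc a b) (C : Set (Set.Icc a b)) (s ε : ℝ)
    (c : Set.Icc a b) (σ : ℕ → ℝ) : Prop where
  pos : 0 < ε
  notMem : ∀ (n : ℕ) (z : Set.Icc a b), 1 ≤ n → s ^ n * |(z : ℝ) - c| ≤ ε → f^[n] z ∉ C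
  abs_sign : ∀ n, |σ n| = 1
  iterate : ∀ (n : ℕ) (z : Set.Icc a b), s ^ n * |(z : ℝ) - c| ≤ ε →
    (f^[n + 1] z : ℝ) = f^[n + 1] c + σ n * (s ^ (n + 1) * |(z : ℝ) - c|)

namespace IsFolding

variable (h : IsFolding f C s)
include h

/-- As long as the iterates are free, a point hitting C while its stretched distance to the orbit of
c is at most ε would ε-link c to C. So nothing is hit, and freeness persists for one more step. -/
lemma exists_isUnlinked {N : ℕ} (hT : IsExact f C N T) (hε : 0 < ε) (hεT : ε ≤ T) (hc : c ∈ C)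
    (hl : ∀ y ∈ C, ¬ IsEpsLinked f ε c y) : ∃ σ, IsUnlinked f C s ε c σ := by
  have hs := h.one_lt
  have hs0 := h.pos
  have hpow : ∀ i : ℕ, 0 < s ^ i := fun i => pow_pos hs0 i
  have hnot : ∀ (n : ℕ) (ρ : ℝ) (z : Set.Icc a b), 1 ≤ n → IsFree f s c n ρ → |(z : ℝ) - c| ≤ ρ →
      s ^ n * |(z : ℝ) - c| ≤ ε → f^[n] z ∉ C := by
    intro n ρ z hn hF hz hzε hzC
    refine hl _ hzC ⟨n, hn, z, rfl, fun j hj => ?_⟩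
    rw [dist_comm, Subtype.dist_eq, Real.dist_eq, hF.dist_iterate hs0 hj hz]
    refine le_trans ?_ hzε
    gcongr
    exact hs.le
  have hle : ∀ n : ℕ, ε / s ^ (n + 1) ≤ ε / s ^ n := fun n => by
    gcongr
    · exact hs.le
    · omega
  have hF : ∀ n, IsFree f s c (n + 1) (ε / s ^ n) := by
    intro n
    induction n with
    | zero => simpa using (h.isFree_one hT hc).mono le_rfl hεT
    | succ n ih =>
      have ih' := ih.mono le_rfl (hle n)
      have hρT : ε / s ^ (n + 1) ≤ T := (div_le_self hε.le (one_le_pow₀ hs.le)).trans hεT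
      obtain ⟨v, hv, -⟩ := h.exists_abs_sub_eq hT hc c
        (div_nonneg hε.le (hpow (n + 1)).le) hρT
      refine h.isFree_succ ⟨v, hv⟩ ih' (by omega) fun z hz e he h1 h2 => ?_
      obtain ⟨w, -, hw, rfl⟩ := h.exists_of_between hT hc hρT ih' (by omega) hz h1 h2
      refine hnot _ _ w (by omega) ih' hw.le ?_ he
      rw [mul_comm, ← le_div_iff₀ (hpow _)]
      exact hw.le
  choose σ hσ H using fun n => hF n (n + 1) (by omega) le_rfl
  refine ⟨σ, hε, fun n z hn hz => ?_, hσ, fun n z hz => H n z ?_⟩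
  · obtain ⟨n, rfl⟩ := Nat.exists_eq_add_of_le' hn
    refine hnot _ _ z hn (hF n) (le_trans ?_ (hle n)) hz
    rwa [le_div_iff₀ (hpow _), mul_comm]
  · rwa [le_div_iff₀ (hpow _), mul_comm]

/-- The inner side contains no point of C up to distance ε, including f^(m+1) c itself. Hence f is
affine across f^(m+1) c, and the outer side is mapped to the outer side. -/
lemma map_outer {N : ℕ} (hT : IsExact f C N T) (hεT : ε ≤ T) (hc : c ∈ C)
    (hu : IsUnlinked f C s ε c σ) {m : ℕ} {y : Set.Icc a b} {q : ℝ} (hq : 0 ≤ q)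
    (hy : (y : ℝ) = f^[m + 1] c - σ m * q)
    (hno : ∀ e ∈ C, |(e : ℝ) - f^[m + 1] c| < q → |(e : ℝ) - y| < q → False)
    {x : Set.Icc a b} {p : ℝ} (hp : 0 ≤ p) (hpq : p ≤ q)
    (hx : (x : ℝ) = f^[m + 1] c - σ m * p) :
    (f x : ℝ) = f^[m + 2] c - σ (m + 1) * (s * p) := by
  have hs := h.one_lt
  have hs0 := h.pos
  have hε := hu.pos
  have hpow : ∀ i : ℕ, 0 < s ^ i := fun i => pow_pos hs0 i
  have hσ := hu.abs_sign m
  have hσ2 : σ m * σ m = 1 := by rw [← abs_mul_abs_self, hσ, one_mul]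
  have hρT : ε / s ^ (m + 1) ≤ T := (div_le_self hε.le (one_le_pow₀ hs.le)).trans hεT
  have hpoint : ∀ ν, 0 ≤ ν → ν ≤ ε → ∃ z : Set.Icc a b, s ^ (m + 1) * |(z : ℝ) - c| = ν ∧
      (f^[m + 1] z : ℝ) = f^[m + 1] c + σ m * ν := by
    intro ν hν hνε
    obtain ⟨z, hz, -⟩ := h.exists_abs_sub_eq hT hc c (t := ν / s ^ (m + 1))
      (div_nonneg hν (hpow _).le) (le_trans (by gcongr) hρT)
    have e : s ^ (m + 1) * |(z : ℝ) - c| = ν := by rw [hz, mul_div_cancel₀ _ (hpow _).ne']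
    refine ⟨z, e, ?_⟩
    rw [hu.iterate m z, e]
    refine le_trans ?_ (e.le.trans hνε)
    gcongr
    · exact hs.le
    · omega
  obtain ⟨z, hz, hzf⟩ := hpoint ε hε.le le_rfl
  have hlen : |(f^[m + 1] z : ℝ) - y| = q + ε := by
    rw [hzf, hy, show (f^[m + 1] c : ℝ) + σ m * ε - (f^[m + 1] c - σ m * q) = σ m * (q + ε) by ring,
      abs_mul, hσ, one_mul, abs_of_nonneg (by linarith)]
  obtain ⟨τ, hτ, H⟩ := h.affine y (f^[m + 1] z) (by
    intro e he h1 h2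
    obtain ⟨ν, hν⟩ : ∃ ν, ν = σ m * ((e : ℝ) - f^[m + 1] c) := ⟨_, rfl⟩
    have hee : (e : ℝ) = f^[m + 1] c + σ m * ν := by rw [hν, ← mul_assoc, hσ2]; ring
    rw [hlen, hee, hy, show (f^[m + 1] c : ℝ) + σ m * ν - (f^[m + 1] c - σ m * q) =
      σ m * (ν + q) by ring, abs_mul, hσ, one_mul, abs_lt] at h1
    rw [hlen, hee, hzf, add_sub_add_left_eq_sub, ← mul_sub, abs_mul, hσ, one_mul, abs_lt] at h2
    rcases le_or_gt 0 ν with h0 | h0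
    · obtain ⟨w, hw, hwf⟩ := hpoint ν h0 (by linarith)
      refine hu.notMem (m + 1) w (by omega) (by linarith) ?_
      rwa [show f^[m + 1] w = e from Subtype.ext (by rw [hwf, hee])]
    · refine hno e he ?_ ?_
      · rw [hee, add_sub_cancel_left, abs_mul, hσ, one_mul, abs_lt]
        constructor <;> linarith
      · rw [hee, hy, show (f^[m + 1] c : ℝ) + σ m * ν - (f^[m + 1] c - σ m * q) =
          σ m * (ν + q) by ring, abs_mul, hσ, one_mul, abs_lt]
        constructor <;> linarith)
  have key : ∀ (x : Set.Icc a b) (p : ℝ), -ε ≤ p → p ≤ q → (x : ℝ) = f^[m + 1] c - σ m * p →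
      (f x : ℝ) = f y + τ * (s * (q - p)) := by
    intro x p hp hpq hx
    have e1 : |(x : ℝ) - y| = q - p := by
      rw [hx, hy, sub_sub_sub_cancel_left, ← mul_sub, abs_mul, hσ, one_mul,
        abs_of_nonneg (by linarith)]
    have e2 : |(x : ℝ) - f^[m + 1] z| = p + ε := by
      rw [hx, hzf, show (f^[m + 1] c : ℝ) - σ m * p - (f^[m + 1] c + σ m * ε) =
        -(σ m * (p + ε)) by ring, abs_neg, abs_mul, hσ, one_mul, abs_of_nonneg (by linarith)]
    have := H x (by rw [e1, hlen]; linarith) (by rw [e2, hlen]; linarith)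
    rwa [e1] at this
  have k1 := key (f^[m + 1] z) (-ε) le_rfl (by linarith) (by rw [hzf]; ring)
  have k2 := key (f^[m + 1] c) 0 (by linarith) hq (by ring)
  have k3 := key x p (by linarith) hpq hx
  have k4 := hu.iterate (m + 1) z hz.le
  rw [show s ^ (m + 1 + 1) * |(z : ℝ) - c| = s * ε by rw [pow_succ' s (m + 1), mul_assoc, hz]]
    at k4
  rw [← Function.iterate_succ_apply' f (m + 1)] at k1 k2
  have hτσ : τ = σ (m + 1) := by
    have : τ * (s * ε) = σ (m + 1) * (s * ε) := by
      rw [show m + 1 + 1 = (m + 1).succ from rfl] at k4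
      linarith
    exact mul_right_cancel₀ (by positivity) this
  rw [k3, ← hτσ, show m + 2 = (m + 1).succ from rfl, k2]
  ring

/-- A jump from the orbit of an unlinked point to the outer side is not shadowed, unless the
interval spanned by the jump is mapped across a point of `C`. -/
lemma exists_hit_of_jump {N : ℕ} (hT : IsExact f C N T) (hεT : ε ≤ T) (hc : c ∈ C)
    (hu : IsUnlinked f C s ε c σ) {r δ : ℝ} (hrε : r ≤ ε)
    (hshadow : ∀ x : ℕ → Set.Icc a b, IsPseudoOrbit f δ x → ∃ z, Shadows f r z x)
    {n : ℕ} {y : Set.Icc a b} {t : ℝ} (ht : 0 < t) (htδ : t < δ)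
    (hy : (y : ℝ) = f^[n + 1] c - σ n * t) :
    ∃ (k : ℕ) (w : Set.Icc a b) (p : ℝ), 0 < p ∧ p < t ∧ s ^ k * t < r ∧
      (w : ℝ) = f^[n + 1] c - σ n * p ∧ f^[k] w ∈ C ∧
      (f^[k] w : ℝ) = f^[n + k + 1] c - σ (n + k) * (s ^ k * p) := by
  have hs := h.one_lt
  have hs0 := h.pos
  have hpow : ∀ i : ℕ, 0 < s ^ i := fun i => pow_pos hs0 i
  -- The pseudo-orbit follows c up to time n and then starts afresh at y. A shadowing point is close
  -- to c at first, so its later images are inner, while those of y remain outer as long as C is not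
  -- hit.
  obtain ⟨z, hz⟩ := hshadow (fun i => if i ≤ n then f^[i] c else f^[i - (n + 1)] y) (by
    intro i
    rcases lt_trichotomy i n with hi | rfl | hi
    · simp only [if_pos hi.le, if_pos (Nat.succ_le_of_lt hi)]
      rw [← Function.iterate_succ_apply' f, dist_self]
      exact ht.trans htδ
    · beta_reduce
      rw [if_pos le_rfl, if_neg (by omega), Nat.sub_self, Function.iterate_zero, id,
        ← Function.iterate_succ_apply' f, Subtype.dist_eq, Real.dist_eq, hy,
        Nat.succ_eq_add_one, sub_sub_cancel, abs_mul, hu.abs_sign, one_mul, abs_of_pos ht]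
      exact htδ
    · beta_reduce
      rw [if_neg (by omega), if_neg (by omega), show i + 1 - (n + 1) = (i - (n + 1)) + 1 by omega,
        Function.iterate_succ_apply', dist_self]
      exact ht.trans htδ)
  have hz0 : ∀ j ≤ n, s ^ j * |(z : ℝ) - c| < r := by
    intro j
    induction j with
    | zero =>
      intro _
      have := hz 0
      simp only [Nat.zero_le, if_true, Function.iterate_zero, id, Subtype.dist_eq,
        Real.dist_eq] at this
      rw [abs_sub_comm] at this
      simpa using this
    | succ j ih =>
      intro hj
      have h1 := ih (by omega)
      have h2 := hz (j + 1)
      beta_reduce at h2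
      rw [if_pos hj, dist_comm, Subtype.dist_eq, Real.dist_eq,
        hu.iterate j z (h1.le.trans hrε), add_sub_cancel_left, abs_mul, hu.abs_sign, one_mul,
        abs_of_nonneg (by positivity)] at h2
      exact h2
  have hdist : ∀ k, s ^ (n + k) * |(z : ℝ) - c| ≤ ε →
      (f^[k] y : ℝ) = f^[n + k + 1] c - σ (n + k) * (s ^ k * t) →
      s ^ (n + k + 1) * |(z : ℝ) - c| + s ^ k * t < r := by
    intro k h1 h2
    have h3 := hz (n + k + 1)
    have h4 : 0 < s ^ k * t := by positivity
    beta_reduce at h3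
    rw [if_neg (by omega), show n + k + 1 - (n + 1) = k by omega, dist_comm, Subtype.dist_eq,
      Real.dist_eq, hu.iterate _ z h1, h2, show ∀ A B D E : ℝ, A + B * D - (A - B * E) =
        B * (D + E) by intros; ring, abs_mul, hu.abs_sign, one_mul,
      abs_of_nonneg (by positivity)] at h3
    exact h3
  by_contra hno
  have key : ∀ k, (∀ (x : Set.Icc a b) (p : ℝ), 0 ≤ p → p ≤ t →
      (x : ℝ) = f^[n + 1] c - σ n * p →
      (f^[k] x : ℝ) = f^[n + k + 1] c - σ (n + k) * (s ^ k * p)) ∧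
      s ^ (n + k + 1) * |(z : ℝ) - c| + s ^ k * t < r := by
    intro k
    induction k with
    | zero =>
      have h0 : ∀ (x : Set.Icc a b) (p : ℝ), 0 ≤ p → p ≤ t →
          (x : ℝ) = f^[n + 1] c - σ n * p →
          (f^[0] x : ℝ) = f^[n + 0 + 1] c - σ (n + 0) * (s ^ 0 * p) := by
        intro x p _ _ hx
        simpa using hx
      exact ⟨h0, hdist 0 ((hz0 n le_rfl).le.trans hrε) (h0 y t ht.le le_rfl hy)⟩
    | succ k ih =>
      obtain ⟨ih1, ih2⟩ := ih
      have hktr : s ^ k * t < r := by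
        have : 0 ≤ s ^ (n + k + 1) * |(z : ℝ) - c| := by positivity
        linarith
      have hkt : 0 < s ^ k * t := by positivity
      have h0 : ∀ (x : Set.Icc a b) (p : ℝ), 0 ≤ p → p ≤ t →
          (x : ℝ) = f^[n + 1] c - σ n * p →
          (f^[k + 1] x : ℝ) = f^[n + (k + 1) + 1] c - σ (n + (k + 1)) * (s ^ (k + 1) * p) := by
        intro x p hp hpt hx
        have := h.map_outer hT hεT hc hu (m := n + k) (y := f^[k] y) (q := s ^ k * t)
          (by positivity) (ih1 y t ht.le le_rfl hy) (by
            intro e he h1 h2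
            have hσ := hu.abs_sign (n + k)
            have hσ2 : σ (n + k) * σ (n + k) = 1 := by rw [← abs_mul_abs_self, hσ, one_mul]
            obtain ⟨ν, hν⟩ : ∃ ν, ν = -(σ (n + k) * ((e : ℝ) - f^[n + k + 1] c)) := ⟨_, rfl⟩
            have hee : (e : ℝ) = f^[n + k + 1] c - σ (n + k) * ν := by
              rw [hν, mul_neg, ← mul_assoc, hσ2]; ring
            rw [hee, sub_sub_cancel_left, abs_neg, abs_mul, hσ, one_mul, abs_lt] at h1
            rw [hee, ih1 y t ht.le le_rfl hy, sub_sub_sub_cancel_left, ← mul_sub, abs_mul, hσ,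
              one_mul, abs_lt] at h2
            have hν0 : 0 < ν := by linarith
            have hp' : ν / s ^ k < t := by rw [div_lt_iff₀ (hpow k)]; linarith
            have hp0 : 0 < ν / s ^ k := div_pos hν0 (hpow k)
            have hmem : (f^[n + 1] c : ℝ) - σ n * (ν / s ^ k) ∈ Set.Icc a b := by
              have m1 := (f^[n + 1] c).2
              have m2 := y.2
              rw [hy] at m2
              rcases eq_or_eq_neg_of_abs_eq (hu.abs_sign n) with hh | hh <;> rw [hh] at m2 ⊢
              · exact ⟨by linarith [m2.1], by linarith [m1.2]⟩
              · exact ⟨by linarith [m1.1], by linarith [m2.2]⟩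
            have hw := ih1 ⟨_, hmem⟩ _ hp0.le hp'.le rfl
            have hwe : f^[k] ⟨_, hmem⟩ = e := Subtype.ext (by
              rw [hw, hee, mul_div_cancel₀ _ (hpow k).ne'])
            exact hno ⟨k, ⟨_, hmem⟩, _, hp0, hp', hktr, rfl, hwe ▸ he, hw⟩)
          (x := f^[k] x) (p := s ^ k * p) (by positivity) (by gcongr) (ih1 x p hp hpt hx)
        rw [Function.iterate_succ_apply', this, pow_succ' s k, mul_assoc]
        rfl
      refine ⟨h0, hdist (k + 1) ?_ (h0 y t ht.le le_rfl hy)⟩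
      rw [← add_assoc]
      linarith
  obtain ⟨k, hk⟩ := pow_unbounded_of_one_lt (r / t) hs
  rw [div_lt_iff₀ ht] at hk
  have h1 := (key k).2
  have : 0 ≤ s ^ (n + k + 1) * |(z : ℝ) - c| := by positivity
  linarith

/-- Jumping right after time 0 produces, for each r, a hit on C at outer distance less than r; as C
is finite, one d serves for all r. -/
lemma exists_outer_accumulation {N : ℕ} (hT : IsExact f C N T) (hεT : ε ≤ T) (hc : c ∈ C)
    (hu : IsUnlinked f C s ε c σ) (hsh : HasShadowing f) :
    ∃ d ∈ C, ∀ r > 0, ∃ m t, 0 < t ∧ t < r ∧ (d : ℝ) = f^[m + 1] c - σ m * t := by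
  have hs := h.one_lt
  have hε := hu.pos
  by_contra! hno
  choose! ρ hρ hρ' using hno
  obtain ⟨r, hr0, hrε, hr⟩ : ∃ r > 0, r ≤ ε ∧ ∀ d ∈ C, r ≤ ρ d := by
    have h1 : ∀ᶠ r in 𝓝[>] (0 : ℝ), ∀ d ∈ C, r ≤ ρ d :=
      (Filter.eventually_all_finite h.finite).2 fun d hd => by
        filter_upwards [Ioo_mem_nhdsGT (hρ d hd)] with r hr using hr.2.le
    obtain ⟨r, ⟨hr, hrε⟩, hr0⟩ :=
      ((h1.and (Ioo_mem_nhdsGT hε)).and self_mem_nhdsWithin).exists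
    exact ⟨r, hr0, hrε.2.le, hr⟩
  obtain ⟨δ, hδ, hshadow⟩ := hsh r hr0
  have hfc : f c ∉ C := hu.notMem 1 c le_rfl (by simpa using hε.le)
  have hfa : a < (f c : ℝ) := lt_of_le_of_ne (f c).2.1 fun e => hfc (h.left_mem _ e.symm)
  have hfb : (f c : ℝ) < b := lt_of_le_of_ne (f c).2.2 fun e => hfc (h.right_mem _ e)
  obtain ⟨t, ht0, htδ, hta, htb⟩ : ∃ t > 0, t < δ ∧ t ≤ f c - a ∧ t ≤ b - f c := by
    refine ⟨min (δ / 2) (min (f c - a) (b - f c)), ?_, ?_, ?_, ?_⟩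
    · exact lt_min (half_pos hδ) (lt_min (by linarith) (by linarith))
    · exact (min_le_left _ _).trans_lt (half_lt_self hδ)
    · exact (min_le_right _ _).trans (min_le_left _ _)
    · exact (min_le_right _ _).trans (min_le_right _ _)
  have hmem : (f c : ℝ) - σ 0 * t ∈ Set.Icc a b := by
    rcases eq_or_eq_neg_of_abs_eq (hu.abs_sign 0) with hh | hh <;> rw [hh] <;>
      constructor <;> linarith
  obtain ⟨k, w, p, hp0, hpt, hkr, -, hwC, hw⟩ := h.exists_hit_of_jump hT hεT hc hu hrε hshadow
    (n := 0) (y := ⟨_, hmem⟩) ht0 htδ rfl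
  refine hρ' _ hwC (0 + k) (s ^ k * p) (mul_pos (pow_pos h.pos k) hp0) (lt_of_lt_of_le ?_ (hr _ hwC))
    hw
  refine lt_trans ?_ hkr
  have := pow_pos h.pos k
  gcongr

/-- A jump onto d yields w between the orbit and d with f^k w ∈ C. At a time when the orbit of c is
even closer to d than w is, some inner point has the same distance to d as w. The fold at d gives
both the same image, so an inner orbit hits C. -/
lemma not_hasShadowing_of_isUnlinked {N : ℕ} (hT : IsExact f C N T) (hεT : ε ≤ T) (hc : c ∈ C)
    (hu : IsUnlinked f C s ε c σ) : ¬ HasShadowing f := by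
  intro hsh
  have hs := h.one_lt
  have hs0 := h.pos
  have hε := hu.pos
  obtain ⟨d, hd, hacc⟩ := h.exists_outer_accumulation hT hεT hc hu hsh
  obtain ⟨δ, hδ, hshadow⟩ := hsh ε hε
  obtain ⟨n, t, ht0, htδ, hdt⟩ := hacc (min δ ε) (lt_min hδ hε)
  obtain ⟨k, w, p, hp0, hpt, hkr, hw, hwC, -⟩ := h.exists_hit_of_jump hT hεT hc hu le_rfl hshadow
    ht0 (htδ.trans_le (min_le_left _ _)) hdt
  have htε : t < ε := htδ.trans_le (min_le_right _ _)
  have hwd : |(w : ℝ) - d| = t - p := by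
    rw [hw, hdt, sub_sub_sub_cancel_left, ← mul_sub, abs_mul, hu.abs_sign, one_mul,
      abs_of_pos (by linarith)]
  obtain ⟨m, t', ht0', htp, hdt'⟩ := hacc (t - p) (by linarith)
  -- The fold only identifies first images, so k = 0 is separate: then w and d would be distinct
  -- points of C within T.
  rcases Nat.eq_zero_or_pos k with rfl | hk
  · have := hT 0 (Nat.zero_le _) d hd w hwC (by
      rw [Function.iterate_zero, id, abs_sub_comm, hwd]; linarith)
    rw [Function.iterate_zero, id] at this
    rw [this, sub_self, abs_zero] at hwd
    linarith
  have hpow : 0 < s ^ (m + 1) := pow_pos hs0 _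
  obtain ⟨z, hz, -⟩ := h.exists_abs_sub_eq hT hc c (t := (t - p - t') / s ^ (m + 1))
    (div_nonneg (by linarith) hpow.le)
    ((div_le_self (by linarith) (one_le_pow₀ hs.le)).trans (by linarith))
  have hzs : s ^ (m + 1) * |(z : ℝ) - c| = t - p - t' := by
    rw [hz, mul_div_cancel₀ _ hpow.ne']
  have hzf := hu.iterate m z (by
    refine le_trans ?_ (show s ^ (m + 1) * |(z : ℝ) - c| ≤ ε by linarith)
    gcongr
    · exact hs.le
    · omega)
  have hzd : |(f^[m + 1] z : ℝ) - d| = |(w : ℝ) - d| := by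
    rw [hwd, hzf, hzs, hdt', show ∀ A B D E : ℝ, A + B * (D - E) - (A - B * E) = B * D by
      intros; ring, abs_mul, hu.abs_sign, one_mul, abs_of_pos (by linarith)]
  have hfeq := h.map_eq_of_abs_sub_eq hT hd (by linarith) hzd
  refine hu.notMem (k + (m + 1)) z (by omega) ?_ ?_
  · rw [pow_add, mul_assoc, hzs]
    refine le_trans ?_ hkr.le
    have := pow_pos hs0 k
    gcongr
    linarith
  · obtain ⟨k, rfl⟩ := Nat.exists_eq_add_of_le' hk
    rwa [Function.iterate_add_apply, Function.iterate_succ_apply, hfeq,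
      ← Function.iterate_succ_apply f]

theorem isLinkedSet_of_hasShadowing (hsh : HasShadowing f) : IsLinkedSet f C := by
  intro c hc
  by_contra! hno
  simp only [IsLinked, not_forall] at hno
  obtain ⟨T, hT0, hT⟩ := exists_isExact h.finite f 0
  choose! η hη hη' using hno
  obtain ⟨ε, hε, hεT, hle⟩ : ∃ ε > 0, ε ≤ T ∧ ∀ y ∈ C, ε ≤ η y := by
    have h1 : ∀ᶠ r in 𝓝[>] (0 : ℝ), ∀ d ∈ C, r ≤ η d :=
      (Filter.eventually_all_finite h.finite).2 fun d hd => by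
        filter_upwards [Ioo_mem_nhdsGT (hη d hd)] with r hr using hr.2.le
    obtain ⟨r, ⟨hr, hrT⟩, hr0⟩ :=
      ((h1.and (Ioo_mem_nhdsGT hT0)).and self_mem_nhdsWithin).exists
    exact ⟨r, hr0, hrT.2.le, hr⟩
  obtain ⟨σ, hu⟩ := h.exists_isUnlinked hT hε hεT hc fun y hy ⟨m, hm, z, hz, H⟩ =>
    hη' y hy ⟨m, hm, z, hz, fun j hj => (H j hj).trans (hle y hy)⟩
  exact h.not_hasShadowing_of_isUnlinked hT hεT hc hu hsh

end IsFolding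

end Linking

/-! ### The equivalences. -/

lemma exists_ne_of_isOpen_Icc {a b : ℝ} (hab : a < b) (U : Set (Set.Icc a b)) (hU : IsOpen U)
    (hne : U.Nonempty) : ∃ x ∈ U, ∃ y ∈ U, x ≠ y := by
  obtain ⟨x, hx⟩ := hne
  have : PreconnectedSpace (Set.Icc a b) := Subtype.preconnectedSpace isPreconnected_Icc
  by_contra! hsub
  have hUx : U = {x} := Set.eq_singleton_iff_unique_mem.2 ⟨hx, fun y hy => hsub y hy x hx⟩
  have hclopen : IsClopen U := ⟨hUx ▸ isClosed_singleton, hU⟩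
  rcases isClopen_iff.1 hclopen with h | h
  · rw [h] at hx
    exact hx
  · have := hsub ⟨a, Set.left_mem_Icc.2 hab.le⟩ (h ▸ Set.mem_univ _)
      ⟨b, Set.right_mem_Icc.2 hab.le⟩ (h ▸ Set.mem_univ _)
    exact hab.ne (congrArg Subtype.val this)

end ShadowingInterval

theorem mainTheorem1 {a b : ℝ} (hab : a < b) (f : Set.Icc a b → Set.Icc a b)
    (hf : Continuous f) (s : ℝ) (hs : 1 < s)
    (hpl : ShadowingInterval.IsPiecewiseLinearConstSlope f s) :
    List.TFAE [ShadowingInterval.HasSLimitShadowing f,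
      ShadowingInterval.HasShadowing f,
      ShadowingInterval.HasLinkingProperty hab.le f] ∧
    (ShadowingInterval.IsTransitive f →
      List.TFAE [ShadowingInterval.HasSLimitShadowing f,
        ShadowingInterval.HasShadowing f,
        ShadowingInterval.HasLinkingProperty hab.le f,
        ShadowingInterval.HasLimitShadowing f]) := by
  have h := hpl.isFolding hab hf hs
  have h12 : ShadowingInterval.HasSLimitShadowing f → ShadowingInterval.HasShadowing f :=
    fun h => h.hasShadowing
  have h23 : ShadowingInterval.HasShadowing f →
      ShadowingInterval.HasLinkingProperty hab.le f := h.isLinkedSet_of_hasShadowing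
  have h31 : ShadowingInterval.HasLinkingProperty hab.le f →
      ShadowingInterval.HasSLimitShadowing f := fun hl => (h.hasPullback hl).hasSLimitShadowing hf
  refine ⟨?_, fun ht => ?_⟩
  · tfae_have 1 → 2 := h12
    tfae_have 2 → 3 := h23
    tfae_have 3 → 1 := h31
    tfae_finish
  · have hsurj := ht.surjective hf (ShadowingInterval.exists_ne_of_isOpen_Icc hab)
    tfae_have 1 → 2 := h12
    tfae_have 2 → 3 := h23
    tfae_have 3 → 1 := h31
    tfae_have 1 → 4 := fun h => h.hasLimitShadowing hsurj
    tfae_have 4 → 2 := fun h => h.hasShadowing hf hsurj ht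
    tfae_finish
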